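/- Let $n\ge 0$ be an integer, and let $K(2,2n+1)$ denote the torus knot of type $(2,2n+1)$, with its standard diagram $D$: the closure of the two-strand braid $\sigma_1^{2n+1}$, with $2n+1$ crossings numbered $1,\dots,2n+1$ along the braid. Classical knots are classes of classical (plane) knot diagrams up to plane isotopy and the Reidemeister moves. A virtual diagram is a plane diagram whose crossings are classical or virtual; welding a classical crossing means making it virtual. Welded knots are classes of virtual diagrams up to plane isotopy, the classical and virtual Reidemeister moves, and the over-forbidden move (a strand that passes over two other strands is moved across a virtual crossing of these two). For a classical knot $K$, the unknotting number $u(K)$ is the minimum, over all classical diagrams of $K$, of the number of crossings that have to be changed to obtain a diagram of the classical unknot. For a welded knot $K$, the welded unknotting number $u_w(K)$ is the minimum, over all virtual diagrams of $K$, of the number of classical crossings that have to be welded to obtain a diagram of the welded unknot; for a classical knot, $u_w$ is that of the welded knot given by its diagrams. A virtual knot diagram is descending if there are a base point and an orientation such that, walking along the diagram from the base point, one meets each classical crossing first on the over-strand and then on the under-strand. Then: 1. Welding the $n$ alternate crossings $2,4,\dots,2n$ of $D$ gives a descending diagram, and this diagram represents the welded unknot. 2. $$u_w(K(2,2n+1))\le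 u(K(2,2n+1))=n.$$ -/

import Mathlib

/-!
Virtual link diagrams in the plane are described as follows. Put the diagram in general position
with respect to the height function and cut it along horizontal lines into slices with exactly
one local minimum (`cup`), local maximum (`cap`) or crossing each. A diagram is then the list of
its slices, read from bottom to top. A slice is determined by its type and by the number of
strands to the left of its special point. Every plane diagram arises in this way, and two lists
describe diagrams that agree up to an isotopy of the plane iff they are related by the moves of
`PlaneIsotopy`.
-/

namespace WeldedKnots

/-- The type of a crossing. Seen from below, one of the two strands goes from the lower left to
the upper right (the slash strand), the other one from the lower right to the upper left (the
backslash strand). A crossing is classical with the slash strand over, classical with the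
backslash strand over, or virtual (also called welded). -/
inductive Crossing where
  | slash : Crossing
  | backslash : Crossing
  | virt : Crossing
  deriving DecidableEq

namespace Crossing

/-- The crossing type is one of the two classical ones. -/
def IsClassical (c : Crossing) : Prop := c ≠ virt

/-- The crossing change: over- and under-strand are exchanged. -/
def switch : Crossing → Crossing
  | slash => backslash
  | backslash => slash
  | virt => virt

/-- Welding a crossing: it is made virtual. -/
def weld : Crossing → Crossing := fun _ => virt

end Crossing

/-- A slice of a plane diagram; the number `i` counts the strands to the left of the special
point. `cup i` is a local minimum (the new strands get the places `i` and `i + 1`), `cap i` is a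
local maximum that joins the strands at the places `i` and `i + 1`, and `crossing c i` is a
crossing of type `c` of the strands at the places `i` and `i + 1`. -/
inductive Slice where
  | cup : ℕ → Slice
  | cap : ℕ → Slice
  | crossing : Crossing → ℕ → Slice
  deriving DecidableEq

namespace Slice

/-- The number of strands to the left of the special point. -/
def pos : Slice → ℕ
  | cup i => i
  | cap i => i
  | crossing _ i => i

/-- The number of strands that come into the special point from below. -/
def ins : Slice → ℕ
  | cup _ => 0
  | cap _ => 2
  | crossing _ _ => 2

/-- The number of strands that leave the special point to the top. -/
def outs : Slice → ℕ
  | cup _ => 2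
  | cap _ => 0
  | crossing _ _ => 2

/-- The slice has its special point to the right of `k` further strands. -/
def shift (k : ℕ) : Slice → Slice
  | cup i => cup (k + i)
  | cap i => cap (k + i)
  | crossing c i => crossing c (k + i)

/-- Change the type of the crossing, if there is one. -/
def mapCrossing (f : Crossing → Crossing) : Slice → Slice
  | cup i => cup i
  | cap i => cap i
  | crossing c i => crossing (f c) i

/-- The slice contains a classical crossing. -/
def HasClassicalCrossing (p : Slice) : Prop := ∃ c i, p = crossing c i ∧ c.IsClassical

/-- The slice contains a virtual crossing. -/
def HasVirtualCrossing (p : Slice) : Prop := ∃ i, p = crossing Crossing.virt i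

end Slice

/-- The slices of the list fit together to a tangle diagram with `m` strands at the bottom and
`n` strands at the top. -/
def IsTangle : ℕ → List Slice → ℕ → Prop
  | m, [], n => m = n
  | m, p :: w, n => p.pos + p.ins ≤ m ∧ IsTangle (m - p.ins + p.outs) w n

/-- Virtual link diagrams in the plane. -/
@[ext]
structure Diagram where
  /-- The slices, from bottom to top. -/
  word : List Slice
  /-- The slices fit together to a closed diagram. -/
  closed : IsTangle 0 word 0

/-! ### Moves -/

/-- The local moves that generate isotopy of diagrams in the plane. -/
inductive PlaneIsotopy : List Slice → List Slice → Prop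
  /-- Two special points pass each other in height; `q` is to the right of `p`, and there are
  `k` strands from `p` to the left end of the part of the diagram to which `q` belongs. -/
  | exchange (p q : Slice) :
      PlaneIsotopy [p, q.shift (p.pos + p.outs)] [q.shift (p.pos + p.ins), p]
  /-- A minimum and an adjacent maximum cancel each other. -/
  | zigzagLeft (i : ℕ) : PlaneIsotopy [Slice.cup i, Slice.cap (i + 1)] []
  | zigzagRight (i : ℕ) : PlaneIsotopy [Slice.cup (i + 1), Slice.cap i] []
  /-- A minimum moves through a crossing. -/
  | turnCup (c : Crossing) (i : ℕ) :
      PlaneIsotopy [Slice.cup i, Slice.crossing c (i + 1)]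
        [Slice.cup (i + 1), Slice.crossing c.switch i]
  /-- A maximum moves through a crossing. -/
  | turnCap (c : Crossing) (i : ℕ) :
      PlaneIsotopy [Slice.crossing c (i + 1), Slice.cap i]
        [Slice.crossing c.switch i, Slice.cap (i + 1)]

/-- The two sides of a move on a triangle formed by three strands `1, 2, 3` (numbered from left
to right at the bottom), where `c₁₂, c₁₃, c₂₃` are the types of their crossings. In the crossing
of two strands, the one with the smaller number is the slash strand. -/
def triangleBefore (c₁₂ c₁₃ c₂₃ : Crossing) (i : ℕ) : List Slice :=
  [Slice.crossing c₁₂ i, Slice.crossing c₁₃ (i + 1), Slice.crossing c₂₃ i]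

/-- The other side of the move that starts with `triangleBefore`. -/
def triangleAfter (c₁₂ c₁₃ c₂₃ : Crossing) (i : ℕ) : List Slice :=
  [Slice.crossing c₂₃ (i + 1), Slice.crossing c₁₃ i, Slice.crossing c₁₂ (i + 1)]

/-- The classical Reidemeister moves. In the third one, the excluded case `c₁₂ = c₂₃ = c₁₃.switch`
is the one where each strand is over one and under the other of the other two strands, so that
no strand is on top. -/
inductive ReidemeisterMove : List Slice → List Slice → Prop
  | r1Cup (c : Crossing) (i : ℕ) (hc : c.IsClassical) :
      ReidemeisterMove [Slice.cup i, Slice.crossing c i] [Slice.cup i]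
  | r1Cap (c : Crossing) (i : ℕ) (hc : c.IsClassical) :
      ReidemeisterMove [Slice.crossing c i, Slice.cap i] [Slice.cap i]
  | r2 (c : Crossing) (i : ℕ) (hc : c.IsClassical) :
      ReidemeisterMove [Slice.crossing c i, Slice.crossing c.switch i] []
  | r3 (c₁₂ c₁₃ c₂₃ : Crossing) (i : ℕ) (h₁₂ : c₁₂.IsClassical) (h₁₃ : c₁₃.IsClassical)
      (h₂₃ : c₂₃.IsClassical) (h : ¬ (c₁₂ = c₂₃ ∧ c₁₃ = c₁₂.switch)) :
      ReidemeisterMove (triangleBefore c₁₂ c₁₃ c₂₃ i) (triangleAfter c₁₂ c₁₃ c₂₃ i)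

/-- The virtual Reidemeister moves. The moves `vr4` move a strand whose two crossings are virtual
through a classical crossing of two other strands. -/
inductive VirtualMove : List Slice → List Slice → Prop
  | vr1Cup (i : ℕ) : VirtualMove [Slice.cup i, Slice.crossing .virt i] [Slice.cup i]
  | vr1Cap (i : ℕ) : VirtualMove [Slice.crossing .virt i, Slice.cap i] [Slice.cap i]
  | vr2 (i : ℕ) : VirtualMove [Slice.crossing .virt i, Slice.crossing .virt i] []
  | vr3 (i : ℕ) :
      VirtualMove (triangleBefore .virt .virt .virt i) (triangleAfter .virt .virt .virt i)
  | vr4First (c : Crossing) (i : ℕ) (hc : c.IsClassical) :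
      VirtualMove (triangleBefore .virt .virt c i) (triangleAfter .virt .virt c i)
  | vr4Second (c : Crossing) (i : ℕ) (hc : c.IsClassical) :
      VirtualMove (triangleBefore .virt c .virt i) (triangleAfter .virt c .virt i)
  | vr4Third (c : Crossing) (i : ℕ) (hc : c.IsClassical) :
      VirtualMove (triangleBefore c .virt .virt i) (triangleAfter c .virt .virt i)

/-- The over-forbidden move: a strand that is over two others moves across a virtual crossing of
these two. -/
inductive OverForbiddenMove : List Slice → List Slice → Prop
  /-- Strand `1` is over the strands `2` and `3`. -/
  | first (i : ℕ) :
      OverForbiddenMove (triangleBefore .slash .slash .virt i)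
        (triangleAfter .slash .slash .virt i)
  /-- Strand `2` is over the strands `1` and `3`. -/
  | second (i : ℕ) :
      OverForbiddenMove (triangleBefore .backslash .virt .slash i)
        (triangleAfter .backslash .virt .slash i)
  /-- Strand `3` is over the strands `1` and `2`. -/
  | third (i : ℕ) :
      OverForbiddenMove (triangleBefore .virt .backslash .backslash i)
        (triangleAfter .virt .backslash .backslash i)

/-- `E` results from `D` by a local move of the kind `M`. -/
def Diagram.MovesTo (M : List Slice → List Slice → Prop) (D E : Diagram) : Prop :=
  ∃ u v L R : List Slice, M L R ∧ D.word = u ++ L ++ v ∧ E.word = u ++ R ++ v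

/-- A diagram without virtual crossings. -/
def Diagram.IsClassical (D : Diagram) : Prop := ∀ p ∈ D.word, ¬ p.HasVirtualCrossing

/-- Classical link diagrams. -/
def ClassicalDiagram : Type := {D : Diagram // D.IsClassical}

/-- One step (in one direction) of the equivalence of classical link diagrams. All diagrams are
classical here. -/
def ClassicalStep (D E : ClassicalDiagram) : Prop :=
  D.1.MovesTo PlaneIsotopy E.1 ∨ D.1.MovesTo ReidemeisterMove E.1

/-- Classical links: classes of the equivalence relation on classical diagrams that is generated
by plane isotopy and the Reidemeister moves. -/
def ClassicalLink : Type := Quot ClassicalStep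

/-- One step (in one direction) of the equivalence of welded link diagrams. -/
def WeldedStep (D E : Diagram) : Prop :=
  D.MovesTo PlaneIsotopy E ∨ D.MovesTo ReidemeisterMove E ∨ D.MovesTo VirtualMove E ∨
    D.MovesTo OverForbiddenMove E

/-- Welded links: classes of the equivalence relation on virtual diagrams that is generated by
plane isotopy, the classical and virtual Reidemeister moves and the over-forbidden move. -/
def WeldedLink : Type := Quot WeldedStep

/-- The classical link of a classical diagram. -/
def ClassicalDiagram.link (D : ClassicalDiagram) : ClassicalLink := Quot.mk _ D

/-- The welded link of a virtual diagram. -/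
def Diagram.weldedLink (D : Diagram) : WeldedLink := Quot.mk _ D

/-! ### Changing and welding crossings -/

/-- Apply `f` to the types of the crossings in the slices whose numbers are in `S` (the slices of
a list are numbered `0, 1, 2, …`). -/
def modifyWord (f : Crossing → Crossing) (S : Finset ℕ) (w : List Slice) : List Slice :=
  w.mapIdx fun k p => if k ∈ S then p.mapCrossing f else p

theorem Slice.pos_mapCrossing (f : Crossing → Crossing) (p : Slice) :
    (p.mapCrossing f).pos = p.pos := by cases p <;> rfl

theorem Slice.ins_mapCrossing (f : Crossing → Crossing) (p : Slice) :
    (p.mapCrossing f).ins = p.ins := by cases p <;> rfl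

theorem Slice.outs_mapCrossing (f : Crossing → Crossing) (p : Slice) :
    (p.mapCrossing f).outs = p.outs := by cases p <;> rfl

theorem isTangle_mapIdx (g : ℕ → Slice → Slice) (hpos : ∀ k p, (g k p).pos = p.pos)
    (hins : ∀ k p, (g k p).ins = p.ins) (houts : ∀ k p, (g k p).outs = p.outs)
    (w : List Slice) (m n : ℕ) : IsTangle m (w.mapIdx g) n ↔ IsTangle m w n := by
  induction w generalizing m g with
  | nil => simp [IsTangle]
  | cons p w ih =>
    rw [List.mapIdx_cons]
    simp only [IsTangle, hpos, hins, houts]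
    rw [ih (fun k => g (k + 1)) (fun k => hpos _) (fun k => hins _) (fun k => houts _)]

theorem isTangle_modifyWord (f : Crossing → Crossing) (S : Finset ℕ) (w : List Slice) (m n : ℕ) :
    IsTangle m (modifyWord f S w) n ↔ IsTangle m w n := by
  apply isTangle_mapIdx
  · intro k p; split_ifs <;> simp [Slice.pos_mapCrossing]
  · intro k p; split_ifs <;> simp [Slice.ins_mapCrossing]
  · intro k p; split_ifs <;> simp [Slice.outs_mapCrossing]

theorem not_hasVirtualCrossing_switch {p : Slice} (hp : ¬ p.HasVirtualCrossing) :
    ¬ (p.mapCrossing Crossing.switch).HasVirtualCrossing := by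
  rintro ⟨i, hi⟩
  rcases p with j | j | ⟨c, j⟩
  · simp [Slice.mapCrossing] at hi
  · simp [Slice.mapCrossing] at hi
  · cases c <;> simp [Slice.mapCrossing, Crossing.switch] at hi
    exact hp ⟨j, rfl⟩

namespace Diagram

/-- The classical crossings of a diagram, given as the numbers of the slices that contain them. -/
def IsCrossingSet (D : Diagram) (S : Finset ℕ) : Prop :=
  ∀ k ∈ S, ∃ p, D.word[k]? = some p ∧ p.HasClassicalCrossing

/-- The diagram that results from changing the crossings in `S`. -/
def switch (D : Diagram) (S : Finset ℕ) : Diagram where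
  word := modifyWord Crossing.switch S D.word
  closed := (isTangle_modifyWord _ _ _ _ _).2 D.closed

/-- The diagram that results from welding the crossings in `S`. -/
def weld (D : Diagram) (S : Finset ℕ) : Diagram where
  word := modifyWord Crossing.weld S D.word
  closed := (isTangle_modifyWord _ _ _ _ _).2 D.closed

theorem IsClassical.switch {D : Diagram} (hD : D.IsClassical) (S : Finset ℕ) :
    (D.switch S).IsClassical := by
  intro p hp
  simp only [Diagram.switch, modifyWord, List.mem_mapIdx] at hp
  obtain ⟨k, hk, rfl⟩ := hp
  have h := hD _ (List.getElem_mem hk)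
  split_ifs
  · exact not_hasVirtualCrossing_switch h
  · exact h

/-- The diagram of the unknot without crossings. -/
def circle : Diagram where
  word := [Slice.cup 0, Slice.cap 0]
  closed := by simp [IsTangle, Slice.pos, Slice.ins, Slice.outs]

theorem isClassical_circle : circle.IsClassical := by
  intro p hp
  simp only [circle, List.mem_cons, List.not_mem_nil, or_false] at hp
  rintro ⟨i, hi⟩
  rcases hp with rfl | rfl <;> cases hi

end Diagram

namespace ClassicalDiagram

/-- The classical diagram that results from changing the crossings in `S`. -/
def switch (D : ClassicalDiagram) (S : Finset ℕ) : ClassicalDiagram :=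
  ⟨D.1.switch S, D.2.switch S⟩

/-- The classical diagram of the unknot without crossings. -/
def circle : ClassicalDiagram := ⟨Diagram.circle, Diagram.isClassical_circle⟩

end ClassicalDiagram

/-- The classical unknot. -/
def ClassicalLink.unknot : ClassicalLink := ClassicalDiagram.circle.link

/-- The welded unknot. -/
def WeldedLink.unknot : WeldedLink := Diagram.circle.weldedLink

/-! ### Unknotting numbers -/

noncomputable section

/-- The minimal number of crossing changes on `D` that lead to a diagram of the unknot. (The value
is `⊤` if there is no such set of crossings, which does not happen for knots.) -/
def ClassicalDiagram.unknottingNumber (D : ClassicalDiagram) : ℕ∞ :=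
  ⨅ (S : Finset ℕ) (_ : D.1.IsCrossingSet S) (_ : (D.switch S).link = ClassicalLink.unknot),
    (S.card : ℕ∞)

/-- The classical unknotting number: the minimum over all classical diagrams of `K`. -/
def ClassicalLink.unknottingNumber (K : ClassicalLink) : ℕ∞ :=
  ⨅ (D : ClassicalDiagram) (_ : D.link = K), D.unknottingNumber

/-- The minimal number of classical crossings of `D` that have to be welded in order to get a
diagram of the welded unknot. (The value is `⊤` if there is no such set of crossings, which does
not happen for knots.) -/
def Diagram.weldedUnknottingNumber (D : Diagram) : ℕ∞ :=
  ⨅ (S : Finset ℕ) (_ : D.IsCrossingSet S) (_ : (D.weld S).weldedLink = WeldedLink.unknot),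
    (S.card : ℕ∞)

/-- The welded unknotting number: the minimum over all virtual diagrams of `K`. -/
def WeldedLink.weldedUnknottingNumber (K : WeldedLink) : ℕ∞ :=
  ⨅ (D : Diagram) (_ : D.weldedLink = K), D.weldedUnknottingNumber

end

/-! ### Descending diagrams -/

/-- A walker on a diagram: it is on the horizontal line below slice number `level`, on the strand
at the place `pos` (counted from `0`), and walks upwards or downwards. -/
@[ext]
structure Walker where
  level : ℕ
  pos : ℕ
  up : Bool

/-- The walker is on a strand of the diagram. -/
def Walker.IsOn (s : Walker) (D : Diagram) : Prop :=
  s.level ≤ D.word.length ∧ ∃ m, IsTangle 0 (D.word.take s.level) m ∧ s.pos < m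

/-- The slice that the walker enters next. -/
def Walker.slice? (s : Walker) (w : List Slice) : Option Slice :=
  if s.up then w[s.level]? else if s.level = 0 then none else w[s.level - 1]?

/-- The position of the walker after it has walked through one slice. Among the places `i` and
`i + 1`, the other one than `s.pos` is `2 * i + 1 - s.pos`. (The cases with result `s` do not
occur on a diagram.) -/
def Walker.next (s : Walker) (w : List Slice) : Walker :=
  match s.slice? w with
  | none => s
  | some p =>
    if s.up then
      if s.pos < p.pos then ⟨s.level + 1, s.pos, true⟩
      else if p.pos + p.ins ≤ s.pos then ⟨s.level + 1, s.pos - p.ins + p.outs, true⟩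
      else match p with
        | .cup _ => s
        | .cap i => ⟨s.level, 2 * i + 1 - s.pos, false⟩
        | .crossing _ i => ⟨s.level + 1, 2 * i + 1 - s.pos, true⟩
    else
      if s.pos < p.pos then ⟨s.level - 1, s.pos, false⟩
      else if p.pos + p.outs ≤ s.pos then ⟨s.level - 1, s.pos - p.outs + p.ins, false⟩
      else match p with
        | .cup i => ⟨s.level, 2 * i + 1 - s.pos, true⟩
        | .cap _ => s
        | .crossing _ i => ⟨s.level - 1, 2 * i + 1 - s.pos, false⟩

/-- In the slice that it enters next, which is slice number `k`, the walker goes through a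
crossing of the type `c` on the slash strand. -/
def Walker.OnSlash (s : Walker) (w : List Slice) (k : ℕ) (c : Crossing) : Prop :=
  (s.up = true ∧ s.level = k ∧ w[k]? = some (.crossing c s.pos)) ∨
    (s.up = false ∧ s.level = k + 1 ∧ ∃ i, s.pos = i + 1 ∧ w[k]? = some (.crossing c i))

/-- In the slice that it enters next, which is slice number `k`, the walker goes through a
crossing of the type `c` on the backslash strand. -/
def Walker.OnBackslash (s : Walker) (w : List Slice) (k : ℕ) (c : Crossing) : Prop :=
  (s.up = true ∧ s.level = k ∧ ∃ i, s.pos = i + 1 ∧ w[k]? = some (.crossing c i)) ∨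
    (s.up = false ∧ s.level = k + 1 ∧ w[k]? = some (.crossing c s.pos))

/-- The walker is about to go over the classical crossing in slice number `k`. -/
def Walker.GoesOver (s : Walker) (w : List Slice) (k : ℕ) : Prop :=
  s.OnSlash w k .slash ∨ s.OnBackslash w k .backslash

/-- The walker is about to go under the classical crossing in slice number `k`. -/
def Walker.GoesUnder (s : Walker) (w : List Slice) (k : ℕ) : Prop :=
  s.OnSlash w k .backslash ∨ s.OnBackslash w k .slash

/-- The position of the walker after it has walked through `t` slices. -/
def Walker.after (s : Walker) (w : List Slice) (t : ℕ) : Walker := (fun r => r.next w)^[t] s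

/-- A (knot) diagram is descending if there are a base point and an orientation such that a walk
from the base point in the direction of the orientation meets each classical crossing first on
the over-strand and then on the under-strand. -/
def Diagram.IsDescending (D : Diagram) : Prop :=
  ∃ s : Walker, s.IsOn D ∧
    ∀ k p, D.word[k]? = some p → p.HasClassicalCrossing →
      ∃ a b : ℕ, a < b ∧ (s.after D.word a).GoesOver D.word k ∧
        (s.after D.word b).GoesUnder D.word k ∧
        ∀ t < b, ¬ (s.after D.word t).GoesUnder D.word k

/-! ### Torus knots -/

/-- The slices of the closure of the two-strand braid with the crossings in `l`. -/
def closedTwoBraidWord (l : List Crossing) : List Slice :=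
  [Slice.cup 0, Slice.cup 1] ++ l.map (fun c => Slice.crossing c 0) ++ [Slice.cap 1, Slice.cap 0]

theorem isTangle_closedTwoBraidWord (l : List Crossing) : IsTangle 0 (closedTwoBraidWord l) 0 := by
  have h : IsTangle 4 (l.map (fun c => Slice.crossing c 0) ++ [Slice.cap 1, Slice.cap 0]) 0 := by
    induction l with
    | nil => simp [IsTangle, Slice.pos, Slice.ins, Slice.outs]
    | cons c l ih => simpa [IsTangle, Slice.pos, Slice.ins, Slice.outs] using ih
  simpa [closedTwoBraidWord, IsTangle, Slice.pos, Slice.ins, Slice.outs] using h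

/-- The standard diagram of the torus knot of type `(2, 2n+1)`: the closure of the two-strand
braid with `2n+1` positive crossings. -/
def torusDiagram (n : ℕ) : Diagram where
  word := closedTwoBraidWord (List.replicate (2 * n + 1) Crossing.slash)
  closed := isTangle_closedTwoBraidWord _

theorem isClassical_torusDiagram (n : ℕ) : (torusDiagram n).IsClassical := by
  intro p hp
  simp only [torusDiagram, closedTwoBraidWord, List.map_replicate, List.mem_append, List.mem_cons,
    List.not_mem_nil, or_false, List.mem_replicate] at hp
  rintro ⟨i, rfl⟩
  simp at hp

/-- The torus knot of type `(2, 2n+1)`, as a classical knot. -/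
def torusKnot (n : ℕ) : ClassicalLink :=
  ClassicalDiagram.link ⟨torusDiagram n, isClassical_torusDiagram n⟩

/-- The torus knot of type `(2, 2n+1)`, as a welded knot. -/
def weldedTorusKnot (n : ℕ) : WeldedLink := (torusDiagram n).weldedLink

/-- The crossings number `2, 4, …, 2n` among the crossings number `1, 2, …, 2n+1` of
`torusDiagram n`. Crossing number `k` is in slice number `k + 1`. -/
def alternateCrossings (n : ℕ) : Finset ℕ := (Finset.Icc 1 n).image fun j => 2 * j + 1

end WeldedKnots

/-! The bound `n ≤ u` comes from the knot signature, computed in the manner of Gordon and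
Litherland. Colour the plane like a checkerboard and give a real variable to each region with an
even number of strands to its left, the outer region having value 0. Each crossing contributes a
signed square of the difference of the two such regions that meet at it. The signature of this
Goeritz form, minus a correction term read off from an orientation, is the signature of the diagram.

To suit the slice description, the form is built by a scan from bottom to top (`wordSig`). Every
slice adds one coordinate: the value of a new region, a Lagrange multiplier that identifies two
regions at a maximum, or a dummy. The algebraic tool is `Reduction.sig_eq`: passing to the
orthogonal complement of a vector `k` modulo `k` changes the signature by the sign of `q k`, whether
`k` is anisotropic, isotropic or in the radical. By `wordSig_of_reduction` such a reduction survives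
all later slices if these do not see `k`. Hence invariance is a local check for each move:
elimination of a multiplier, of a leaf (the first Reidemeister move) or of the centre of a star (the
third). A crossing change moves the signature by at most 2. The unknot has signature 0 and the torus
knot has signature -2n, so at least `n` changes are needed.

For `u ≤ n`, switching the alternate crossings makes neighbouring crossings cancel in pairs.

Welding the same crossings gives the closed braid of alternating classical and virtual crossings. A
walk along it shows that it is descending. That it is unknotted is proved independently, by
induction (`WeldedEq.twists_succ`): on an added third strand, the last classical crossing is pulled
past all other pairs, because the same strand is over everywhere and two overpasses of one strand
commute by the over-forbidden move. It then becomes a kink and disappears. So `u_w ≤ n = u`. -/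

namespace WeldedKnots

open QuadraticMap Module

/-! ### Signatures of real quadratic forms under reduction along a vector. -/

section Signature

variable {E F V : Type} [AddCommGroup E] [Module ℝ E] [AddCommGroup F] [Module ℝ F]
  [AddCommGroup V] [Module ℝ V]

/-- A reduction of `(E, q)` along the vector `k`: `F` is a complement of `k` in the orthogonal
complement of `k`, or contains one up to null vectors. -/
structure Reduction (q : QuadraticForm ℝ E) (p : QuadraticForm ℝ F) (k : E) (j : F →ₗ[ℝ] E)
    (pr : E →ₗ[ℝ] F) : Prop where
  polar_eq : ∀ f, polar q k (j f) = 0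
  map_eq : ∀ f, q (j f) = p f
  split : ∀ e, polar q k e = 0 → ∃ c : ℝ, e = j (pr e) + c • k

theorem Reduction.neg {q : QuadraticForm ℝ E} {p : QuadraticForm ℝ F} {k : E} {j : F →ₗ[ℝ] E}
    {pr : E →ₗ[ℝ] F} (h : Reduction q p k j pr) : Reduction (-q) (-p) k j pr where
  polar_eq f := by
    have := h.polar_eq f
    simp only [polar, neg_apply] at this ⊢
    linarith
  map_eq f := by simp [h.map_eq]
  split e he := by
    apply h.split
    simp only [polar, neg_apply] at he ⊢
    linarith

theorem map_add_smul (q : QuadraticForm ℝ E) (x y : E) (c : ℝ) :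
    q (x + c • y) = q x + c * polar q x y + c * c * q y := by
  have : polar q x (c • y) = c * polar q x y := by
    rw [QuadraticMap.polar_smul_right, smul_eq_mul]
  have h2 : q (c • y) = c * c * q y := by rw [QuadraticMap.map_smul, smul_eq_mul]
  rw [polar, h2] at this
  linarith

variable {q : QuadraticForm ℝ E} {p : QuadraticForm ℝ F} {k : E} {j : F →ₗ[ℝ] E}
  {pr : E →ₗ[ℝ] F}

theorem Reduction.eq_on_perp (h : Reduction q p k j pr) {e : E} (he : polar q k e = 0) :
    ∃ c : ℝ, q e = p (pr e) + c * c * q k := by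
  obtain ⟨c, hc⟩ := h.split e he
  refine ⟨c, ?_⟩
  have h1 := map_add_smul q (j (pr e)) k c
  rw [← hc, polar_comm, h.polar_eq, h.map_eq] at h1
  linarith

variable [FiniteDimensional ℝ E] [FiniteDimensional ℝ F]

/-- The dimension of a space is bounded by the positive index of a form that pulls back to a
positive definite one. -/
theorem finrank_le_sigPos (p : QuadraticForm ℝ F) (T : V →ₗ[ℝ] F)
    (h : ∀ v, v ≠ 0 → 0 < p (T v)) : finrank ℝ V ≤ sigPos p := by
  have hinj : Function.Injective T := by
    rw [← LinearMap.ker_eq_bot, Submodule.eq_bot_iff]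
    intro v hv
    by_contra hne
    have := h v hne
    rw [LinearMap.mem_ker.1 hv] at this
    simp at this
  rw [← LinearMap.finrank_range_of_inj hinj]
  apply le_sigPos_of_posDef
  rintro ⟨_, v, rfl⟩ hne
  rw [QuadraticMap.restrict_apply]
  apply h
  rintro rfl
  exact hne (by simp)

theorem exists_sigPos (q : QuadraticForm ℝ E) :
    ∃ W : Submodule ℝ E, finrank ℝ W = sigPos q ∧ ∀ w ∈ W, w ≠ 0 → 0 < q w := by
  obtain ⟨W, hW, hpos⟩ := exists_finrank_eq_sigPos_and_posDef q
  refine ⟨W, hW, fun w hw hne => ?_⟩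
  have := hpos ⟨w, hw⟩ (by simpa using hne)
  simpa using this

theorem finrank_le_finrank_ker_add_one [FiniteDimensional ℝ V] (l : V →ₗ[ℝ] ℝ) :
    finrank ℝ V ≤ finrank ℝ (LinearMap.ker l) + 1 := by
  have h1 := LinearMap.finrank_range_add_finrank_ker l
  have h2 := Submodule.finrank_le (LinearMap.range l)
  rw [finrank_self] at h2
  omega

/-- A maximal positive definite subspace of `q` is carried injectively to a positive definite
subspace of `p`. -/
theorem sigPos_le_of_ge {q : QuadraticForm ℝ E} {p : QuadraticForm ℝ F} (T : E →ₗ[ℝ] F)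
    (h : ∀ e, q e ≤ p (T e)) : sigPos q ≤ sigPos p := by
  obtain ⟨W, hW, hpos⟩ := exists_sigPos q
  rw [← hW]
  apply finrank_le_sigPos p (T ∘ₗ W.subtype)
  intro v hv
  exact (hpos v v.2 (by simpa using hv)).trans_le (h v)

/-- Cutting a positive definite subspace with the hyperplane `l = 0` costs at most one dimension. -/
theorem sigPos_le_of_ge_on_ker {q : QuadraticForm ℝ E} {p : QuadraticForm ℝ F} (T : E →ₗ[ℝ] F)
    (l : E →ₗ[ℝ] ℝ) (h : ∀ e, l e = 0 → q e ≤ p (T e)) : sigPos q ≤ sigPos p + 1 := by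
  obtain ⟨W, hW, hpos⟩ := exists_sigPos q
  rw [← hW]
  refine (finrank_le_finrank_ker_add_one (l ∘ₗ W.subtype)).trans (Nat.add_le_add_right ?_ 1)
  apply finrank_le_sigPos p (T ∘ₗ W.subtype ∘ₗ Submodule.subtype _)
  intro v hv
  exact (hpos v.1 v.1.2 (by simpa using hv)).trans_le (h _ (LinearMap.mem_ker.1 v.2))

/-- The signature of a quadratic form. -/
noncomputable def sig (q : QuadraticForm ℝ E) : ℤ := sigPos q - sigNeg q

theorem Reduction.le_sigPos (h : Reduction q p k j pr) : sigPos p ≤ sigPos q :=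
  sigPos_le_of_ge j fun f => (h.map_eq f).ge

theorem Reduction.sigPos_le_add_one (h : Reduction q p k j pr) :
    sigPos q ≤ sigPos p + 1 := by
  refine sigPos_le_of_ge_on_ker pr (QuadraticMap.polarBilin q k) fun e he => ?_
  have he' : polar q k e = 0 := he
  obtain ⟨c, hc⟩ := h.split e he'
  obtain hk | hk := le_or_gt (q k) 0
  · obtain ⟨c, hc⟩ := h.eq_on_perp he'
    nlinarith [mul_self_nonneg c]
  -- A positive `k` is not orthogonal to itself, so the multiple of `k` in the decomposition of `e`
  -- vanishes.
  · have h1 : polar q k e = polar q k (j (pr e)) + c * polar q k k := by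
      conv_lhs => rw [hc]
      rw [QuadraticMap.polar_add_right, QuadraticMap.polar_smul_right, smul_eq_mul]
    have h2 : polar q k k = 2 * q k := by
      rw [QuadraticMap.polar_self]; simp
    rw [he', h.polar_eq, h2] at h1
    have hc0 : c = 0 := by
      have : c * q k = 0 := by linarith
      rcases mul_eq_zero.1 this with h | h
      · exact h
      · exact absurd h hk.ne'
    rw [hc0, zero_smul, add_zero] at hc
    conv_lhs => rw [hc]
    exact (h.map_eq _).le

theorem Reduction.sigPos_of_neg (h : Reduction q p k j pr) (hk : q k < 0) :
    sigPos q = sigPos p := by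
  refine le_antisymm ?_ h.le_sigPos
  have h2 : polar q k k = 2 * q k := by rw [QuadraticMap.polar_self]; simp
  -- `T` is the orthogonal projection along `k`. It removes a nonpositive part of `q`, so it does
  -- not decrease `q`.
  let T : E →ₗ[ℝ] E := LinearMap.id - (LinearMap.toSpanSingleton ℝ E k) ∘ₗ
    ((2 * q k)⁻¹ • QuadraticMap.polarBilin q k)
  have hT : ∀ e, T e = e + (-((2 * q k)⁻¹ * polar q k e)) • k := by
    intro e
    simp [T, sub_eq_add_neg]
  refine sigPos_le_of_ge (pr ∘ₗ T) fun e => ?_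
  have h0 : polar q k (T e) = 0 := by
    rw [hT, QuadraticMap.polar_add_right, QuadraticMap.polar_smul_right, smul_eq_mul, h2]
    have := hk.ne
    field_simp
    ring
  obtain ⟨c, hc⟩ := h.eq_on_perp h0
  have h3 := map_add_smul q e k (-((2 * q k)⁻¹ * polar q k e))
  rw [← hT, polar_comm q e k] at h3
  have h4 : q (T e) = q e - (polar q k e) ^ 2 * (4 * q k)⁻¹ := by
    rw [h3]
    field_simp
    ring
  have h5 : (polar q k e) ^ 2 * (4 * q k)⁻¹ ≤ 0 :=
    mul_nonpos_of_nonneg_of_nonpos (sq_nonneg _) (inv_nonpos.2 (by linarith))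
  have h6 : c * c * q k ≤ 0 := mul_nonpos_of_nonneg_of_nonpos (mul_self_nonneg _) hk.le
  simp only [LinearMap.comp_apply]
  linarith

/-- A positive vector orthogonal to the image of a positive definite subspace enlarges that
subspace. The vector may depend on `W`; this freedom is needed when `k` is isotropic. -/
theorem Reduction.add_one_le_sigPos (h : Reduction q p k j pr)
    (hx : ∀ W : Submodule ℝ F, (∀ w ∈ W, w ≠ 0 → 0 < p w) →
      ∃ x : E, 0 < q x ∧ ∀ w ∈ W, polar q (j w) x = 0) : sigPos p + 1 ≤ sigPos q := by
  obtain ⟨W, hW, hpos⟩ := exists_sigPos p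
  obtain ⟨x, hx, hort⟩ := hx W hpos
  have hfin : finrank ℝ (W × ℝ) = sigPos p + 1 := by rw [finrank_prod, hW, finrank_self]
  rw [← hfin]
  refine finrank_le_sigPos q ((j ∘ₗ W.subtype).coprod (LinearMap.toSpanSingleton ℝ E x)) ?_
  rintro ⟨w, c⟩ hne
  have h1 := map_add_smul q (j w) x c
  rw [hort w w.2, h.map_eq] at h1
  simp only [LinearMap.coprod_apply, LinearMap.comp_apply, Submodule.subtype_apply,
    LinearMap.toSpanSingleton_apply]
  rw [h1]
  by_cases hw : w = 0
  · subst hw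
    have hc : c ≠ 0 := by
      rintro rfl
      exact hne rfl
    have := mul_pos (mul_self_pos.2 hc) hx
    simpa using this
  · have h2 := hpos w w.2 (by simpa using hw)
    have h3 := mul_nonneg (mul_self_nonneg c) hx.le
    linarith

/-- A positive definite subspace has an orthogonal projection. -/
theorem exists_polar_eq (p : QuadraticForm ℝ F) (W : Submodule ℝ F)
    (hW : ∀ w ∈ W, w ≠ 0 → 0 < p w) (l : W →ₗ[ℝ] ℝ) :
    ∃ x ∈ W, ∀ w : W, polar p w x = l w := by
  let B : W →ₗ[ℝ] (W →ₗ[ℝ] ℝ) :=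
    (LinearMap.lcomp ℝ ℝ W.subtype) ∘ₗ (QuadraticMap.polarBilin p) ∘ₗ W.subtype
  have hB : ∀ x w : W, B x w = polar p x w := fun x w => rfl
  -- A vector in the kernel pairs to zero with itself, which definiteness excludes; in finite
  -- dimension `B` then reaches every linear form.
  have hinj : Function.Injective B := by
    rw [← LinearMap.ker_eq_bot, Submodule.eq_bot_iff]
    intro v hv
    by_contra hne
    have h1 := hB v v
    rw [LinearMap.mem_ker.1 hv, QuadraticMap.polar_self] at h1
    have := hW v v.2 (by simpa using hne)
    simp at h1
    linarith
  have hsurj : Function.Surjective B :=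
    (LinearMap.injective_iff_surjective_of_finrank_eq_finrank
      (Subspace.dual_finrank_eq (K := ℝ) (V := W)).symm).1 hinj
  obtain ⟨x, hx⟩ := hsurj l
  refine ⟨x, x.2, fun w => ?_⟩
  rw [← hx, hB, polar_comm]

theorem Reduction.add_one_le_sigPos_of_pos (h : Reduction q p k j pr) (hk : 0 < q k) :
    sigPos p + 1 ≤ sigPos q :=
  h.add_one_le_sigPos fun _ _ => ⟨k, hk, fun w _ => by rw [polar_comm]; exact h.polar_eq w⟩

/-- The vectors `k` and `x` span a hyperbolic plane, which contributes a positive direction. -/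
theorem Reduction.add_one_le_sigPos_of_isotropic (h : Reduction q p k j pr) (hk : q k = 0)
    {x : E} (hx : polar q k x ≠ 0) : sigPos p + 1 ≤ sigPos q := by
  refine h.add_one_le_sigPos fun W hW => ?_
  obtain ⟨y, -, hy⟩ := exists_polar_eq p W hW
    ((QuadraticMap.polarBilin q x) ∘ₗ j ∘ₗ W.subtype)
  have hjy : ∀ w ∈ W, polar q (j w) (j y) = polar q (j w) x := by
    intro w hw
    have h1 := hy ⟨w, hw⟩
    simp only [LinearMap.comp_apply, Submodule.subtype_apply, QuadraticMap.polarBilin_apply_apply]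
      at h1
    rw [polar_comm q (j w) x, ← h1, polar, polar, ← map_add, h.map_eq, h.map_eq, h.map_eq]
  -- Subtracting the projection of `x` to `W` makes it orthogonal to `j W` and keeps its pairing
  -- with `k`.
  let z := x + (-1 : ℝ) • j y
  have hz : polar q k z = polar q k x := by
    simp only [z]
    rw [QuadraticMap.polar_add_right, QuadraticMap.polar_smul_right, h.polar_eq]
    simp
  -- Since `q k = 0`, the value of `q` at `z + c • k` is affine in `c`; this `c` makes it equal to
  -- 1.
  let c : ℝ := (1 - q z) / polar q k x
  refine ⟨z + c • k, ?_, fun w hw => ?_⟩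
  · rw [map_add_smul, hk, polar_comm, hz]
    have : c * polar q k x = 1 - q z := div_mul_cancel₀ _ hx
    linarith
  · rw [QuadraticMap.polar_add_right, QuadraticMap.polar_smul_right, polar_comm q (j w) k,
      h.polar_eq]
    simp only [z]
    rw [QuadraticMap.polar_add_right, QuadraticMap.polar_smul_right, hjy w hw]
    simp

theorem Reduction.sigPos_of_radical (h : Reduction q p k j pr) (hk : ∀ x, polar q k x = 0) :
    sigPos q = sigPos p := by
  have hk0 : q k = 0 := by
    have := hk k
    rw [QuadraticMap.polar_self] at this
    simpa using this
  refine le_antisymm (sigPos_le_of_ge pr fun e => ?_) h.le_sigPos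
  obtain ⟨c, hc⟩ := h.eq_on_perp (hk e)
  rw [hc, hk0]
  simp

/-- If `q k ≠ 0`, the line of `k` splits off. If `k` is isotropic outside the radical, a hyperbolic
plane of signature 0 splits off. If `k` is in the radical, it contributes nothing. Negative indices
follow from the same estimates for `-q`. -/
theorem Reduction.sig_eq (h : Reduction q p k j pr) : sig q = sig p + SignType.sign (q k) := by
  have hn := h.neg
  unfold sig
  rw [← sigPos_neg, ← sigPos_neg]
  have ub := h.sigPos_le_add_one
  have ubn := hn.sigPos_le_add_one
  rcases lt_trichotomy (q k) 0 with hk | hk | hk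
  · have h1 := h.sigPos_of_neg hk
    have h2 := hn.add_one_le_sigPos_of_pos (by simpa using hk)
    rw [sign_neg hk, SignType.coe_neg_one]
    omega
  · rw [hk, sign_zero, SignType.coe_zero]
    by_cases hr : ∀ x, polar q k x = 0
    · rw [h.sigPos_of_radical hr, hn.sigPos_of_radical]
      · simp
      · intro x
        have := hr x
        simp only [polar, neg_apply] at this ⊢
        linarith
    · push Not at hr
      obtain ⟨x, hx⟩ := hr
      have h1 := h.add_one_le_sigPos_of_isotropic hk hx
      have h2 := hn.add_one_le_sigPos_of_isotropic (by simpa using hk) (x := x) (by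
        simp only [polar, neg_apply] at hx ⊢
        intro h0
        apply hx
        linarith)
      omega
  · have h1 := hn.sigPos_of_neg (by simpa using hk)
    have h2 := h.add_one_le_sigPos_of_pos hk
    rw [sign_pos hk, SignType.coe_one]
    omega

/-- Each index is monotone and changes by at most one, because the two forms agree on a hyperplane
or on the whole space. This is the algebra of a crossing change. -/
theorem sig_le_of_le_add_sq {q q' : QuadraticForm ℝ E} (l : E →ₗ[ℝ] ℝ) (h : ∀ e, q e ≤ q' e)
    (hl : ∀ e, l e = 0 → q' e = q e) : sig q ≤ sig q' ∧ sig q' ≤ sig q + 2 := by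
  unfold sig
  rw [← sigPos_neg, ← sigPos_neg]
  have h1 : sigPos q ≤ sigPos q' := sigPos_le_of_ge LinearMap.id h
  have h2 : sigPos (-q') ≤ sigPos (-q) :=
    sigPos_le_of_ge LinearMap.id fun e => by simpa using h e
  have h3 : sigPos q' ≤ sigPos q + 1 :=
    sigPos_le_of_ge_on_ker LinearMap.id l fun e he => (hl e he).le
  have h4 : sigPos (-q) ≤ sigPos (-q') + 1 :=
    sigPos_le_of_ge_on_ker LinearMap.id l fun e he => by simpa using (hl e he).le
  omega

end Signature

/-! ### The Goeritz form, built up slice by slice. -/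

section States

/-- The sign of a crossing with respect to the colouring of its left and right regions. -/
def Crossing.weight : Crossing → ℤ
  | slash => 1
  | backslash => -1
  | virt => 0

theorem Crossing.weight_switch (c : Crossing) : c.switch.weight = -c.weight := by
  cases c <;> rfl

/-- The regions of a diagram with an even number of strands to their left are numbered by half
that number. Given values `x` of these regions below a slice, and the value `t` of the region that
starts in the slice (if there is one), this is the sequence of values above the slice. -/
def regionFun : Slice → (ℕ → ℝ) → ℝ → ℕ → ℝ
  | .cup i, x, t => fun j =>
      if j ≤ i / 2 then x j else if i % 2 = 1 ∧ j = i / 2 + 1 then t else x (j - 1)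
  | .cap i, x, _ => fun j => if j ≤ i / 2 then x j else x (j + 1)
  | .crossing _ i, x, t => fun j => if i % 2 = 1 ∧ j = i / 2 + 1 then t else x j

/-- The contribution of a slice to the Goeritz form. At a maximum that merges two regions, `t` is
a Lagrange multiplier. -/
def energyFun : Slice → (ℕ → ℝ) → ℝ → ℝ
  | .cup _, _, _ => 0
  | .cap i, x, t => if i % 2 = 0 then t * (x (i / 2) - x (i / 2 + 1)) else 0
  | .crossing c i, x, t =>
      if i % 2 = 0 then c.weight * (x (i / 2) - x (i / 2 + 1)) ^ 2
      else -c.weight * (x (i / 2 + 1) - t) ^ 2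

/-- `regionFun` as a linear map. -/
def regionMap (p : Slice) : ((ℕ → ℝ) × ℝ) →ₗ[ℝ] (ℕ → ℝ) where
  toFun z := regionFun p z.1 z.2
  map_add' y z := by
    funext j
    cases p <;> simp only [regionFun, Pi.add_apply, Prod.fst_add, Prod.snd_add] <;> split_ifs <;> rfl
  map_smul' c z := by
    funext j
    cases p <;> simp only [regionFun, Pi.smul_apply, Prod.smul_fst, Prod.smul_snd,
      RingHom.id_apply] <;> split_ifs <;> rfl

@[simp]
theorem regionMap_apply (p : Slice) (z : (ℕ → ℝ) × ℝ) : regionMap p z = regionFun p z.1 z.2 := rfl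

/-- The value of a region as a linear form. -/
def regionValue (j : ℕ) : ((ℕ → ℝ) × ℝ) →ₗ[ℝ] ℝ := LinearMap.proj j ∘ₗ LinearMap.fst ℝ (ℕ → ℝ) ℝ

/-- The value of the new region as a linear form. -/
def newValue : ((ℕ → ℝ) × ℝ) →ₗ[ℝ] ℝ := LinearMap.snd ℝ (ℕ → ℝ) ℝ

/-- `energyFun` as a quadratic form. -/
noncomputable def energy : Slice → QuadraticForm ℝ ((ℕ → ℝ) × ℝ)
  | .cup _ => 0
  | .cap i =>
      if i % 2 = 0 then linMulLin newValue (regionValue (i / 2) - regionValue (i / 2 + 1)) else 0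
  | .crossing c i =>
      if i % 2 = 0 then linMulLin ((c.weight : ℝ) • (regionValue (i / 2) - regionValue (i / 2 + 1)))
        (regionValue (i / 2) - regionValue (i / 2 + 1))
      else linMulLin ((-c.weight : ℝ) • (regionValue (i / 2 + 1) - newValue))
        (regionValue (i / 2 + 1) - newValue)

@[simp]
theorem energy_apply (p : Slice) (z : (ℕ → ℝ) × ℝ) : energy p z = energyFun p z.1 z.2 := by
  cases p <;> simp only [energy, energyFun] <;> (try split_ifs) <;>
    simp [regionValue, newValue, pow_two] <;> ring

theorem energyFun_zero (p : Slice) : energyFun p 0 0 = 0 := by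
  cases p <;> simp [energyFun]

variable {E F : Type} [AddCommGroup E] [Module ℝ E] [AddCommGroup F] [Module ℝ F]

/-- The form on the values of the regions after one more slice. -/
noncomputable def nextForm (p : Slice) (q : QuadraticForm ℝ E) (φ : E →ₗ[ℝ] (ℕ → ℝ)) :
    QuadraticForm ℝ (E × ℝ) :=
  q.comp (LinearMap.fst ℝ E ℝ) + (energy p).comp (φ.prodMap LinearMap.id)

/-- The values of the regions after one more slice. -/
def nextValues (p : Slice) (φ : E →ₗ[ℝ] (ℕ → ℝ)) : (E × ℝ) →ₗ[ℝ] (ℕ → ℝ) :=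
  regionMap p ∘ₗ φ.prodMap LinearMap.id

@[simp]
theorem nextForm_apply (p : Slice) (q : QuadraticForm ℝ E) (φ : E →ₗ[ℝ] (ℕ → ℝ)) (z : E × ℝ) :
    nextForm p q φ z = q z.1 + energyFun p (φ z.1) z.2 := by
  simp [nextForm]

@[simp]
theorem nextValues_apply (p : Slice) (φ : E →ₗ[ℝ] (ℕ → ℝ)) (z : E × ℝ) :
    nextValues p φ z = regionFun p (φ z.1) z.2 := rfl

/-- The signature of the form that results from `q` by adding the contributions of the slices of a
list; `φ` gives the values of the regions below these slices. -/
noncomputable def wordSig : List Slice → (E : Type) → [AddCommGroup E] → [Module ℝ E] →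
    QuadraticForm ℝ E → (E →ₗ[ℝ] (ℕ → ℝ)) → ℤ
  | [], _, _, _, q, _ => sig q
  | p :: w, E, _, _, q, φ => wordSig w (E × ℝ) (nextForm p q φ) (nextValues p φ)

theorem wordSig_congr {q p : QuadraticForm ℝ E} {φ ψ : E →ₗ[ℝ] (ℕ → ℝ)} (w : List Slice)
    (h : ∀ e, q e = p e) (h' : ∀ e, φ e = ψ e) : wordSig w E q φ = wordSig w E p ψ := by
  rw [show q = p from QuadraticMap.ext h, show φ = ψ from LinearMap.ext h']

theorem polar_nextForm (p : Slice) (q : QuadraticForm ℝ E) (φ : E →ₗ[ℝ] (ℕ → ℝ)) {k : E}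
    (hk : φ k = 0) (z : E × ℝ) : polar (nextForm p q φ) (k, 0) z = polar q k z.1 := by
  simp only [polar, nextForm_apply, Prod.fst_add, Prod.snd_add, map_add, hk, zero_add, energyFun_zero]
  ring

/-- Later slices depend on a vector only through its region values. Since `φ k = 0`, they add
nothing to `q k` or to the pairings with `k`, so the reduction persists to the end of the word. This
makes the invariance checks local. -/
theorem wordSig_of_reduction [FiniteDimensional ℝ E] [FiniteDimensional ℝ F] (w : List Slice)
    {q : QuadraticForm ℝ E} {p : QuadraticForm ℝ F}
    {φ : E →ₗ[ℝ] (ℕ → ℝ)} {ψ : F →ₗ[ℝ] (ℕ → ℝ)} {k : E} {j : F →ₗ[ℝ] E} {pr : E →ₗ[ℝ] F}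
    (h : Reduction q p k j pr) (hk : φ k = 0) (hj : ∀ f, φ (j f) = ψ f) :
    wordSig w E q φ = wordSig w F p ψ + SignType.sign (q k) := by
  induction w generalizing E F with
  | nil => exact h.sig_eq
  | cons s w ih =>
    have hs : nextForm s q φ (k, 0) = q k := by simp [hk, energyFun_zero]
    rw [wordSig, wordSig, ← hs]
    refine ih (j := j.prodMap LinearMap.id) (pr := pr.prodMap LinearMap.id) ⟨?_, ?_, ?_⟩ ?_ ?_
    · intro f
      rw [polar_nextForm s q φ hk]
      exact h.polar_eq _
    · intro f
      simp [h.map_eq, hj]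
    · rintro ⟨e, t⟩ he
      rw [polar_nextForm s q φ hk] at he
      obtain ⟨c, hc⟩ := h.split e he
      exact ⟨c, Prod.ext hc (by simp)⟩
    · rw [nextValues_apply, hk]
      exact map_zero (regionMap s)
    · intro f
      simp [hj]

/-- A change of coordinates is a reduction along the zero vector. -/
theorem wordSig_of_equiv [FiniteDimensional ℝ E] [FiniteDimensional ℝ F] (w : List Slice)
    {q : QuadraticForm ℝ E} {p : QuadraticForm ℝ F}
    {φ : E →ₗ[ℝ] (ℕ → ℝ)} {ψ : F →ₗ[ℝ] (ℕ → ℝ)} (f : E ≃ₗ[ℝ] F) (hq : ∀ e, q e = p (f e))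
    (hφ : ∀ e, φ e = ψ (f e)) : wordSig w E q φ = wordSig w F p ψ := by
  have h : Reduction q p 0 (f.symm : F →ₗ[ℝ] E) (f : E →ₗ[ℝ] F) :=
    ⟨fun _ => by simp [polar], fun _ => by simp [hq], fun e _ => ⟨0, by simp⟩⟩
  have := wordSig_of_reduction w (φ := φ) (ψ := ψ) h (map_zero φ) (fun e => by simp [hφ])
  simpa using this

/-- No region starts in the slice, and there is no Lagrange multiplier. -/
def Slice.IsStatic (p : Slice) : Prop :=
  ∀ x t, energyFun p x t = energyFun p x 0 ∧ regionFun p x t = regionFun p x 0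

/-- The coordinate added by a static slice is a dummy: it lies in the radical and is invisible to
later slices, so it can be dropped. -/
theorem wordSig_cons_of_isStatic [FiniteDimensional ℝ E] {s : Slice} (hs : s.IsStatic)
    (w : List Slice) (q : QuadraticForm ℝ E) (φ : E →ₗ[ℝ] (ℕ → ℝ)) :
    wordSig (s :: w) E q φ =
      wordSig w E ((nextForm s q φ).comp (LinearMap.inl ℝ E ℝ))
        (nextValues s φ ∘ₗ LinearMap.inl ℝ E ℝ) := by
  have h1 : energyFun s 0 1 = 0 := (hs 0 1).1.trans (energyFun_zero s)
  have h : Reduction (nextForm s q φ) ((nextForm s q φ).comp (LinearMap.inl ℝ E ℝ))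
      ((0 : E), (1 : ℝ)) (LinearMap.inl ℝ E ℝ) (LinearMap.fst ℝ E ℝ) := by
    refine ⟨fun f => ?_, fun f => rfl, fun e _ => ⟨e.2, by ext <;> simp⟩⟩
    simp only [polar, nextForm_apply, LinearMap.inl_apply, Prod.fst_add, Prod.snd_add, zero_add,
      map_zero, h1, (hs _ (1 + 0)).1]
    ring
  have h2 : nextValues s φ ((0 : E), (1 : ℝ)) = 0 := by
    rw [nextValues_apply, map_zero, (hs _ _).2]
    exact map_zero (regionMap s)
  rw [wordSig, wordSig_of_reduction w (ψ := nextValues s φ ∘ₗ LinearMap.inl ℝ E ℝ) h h2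
    (fun f => rfl)]
  simp [h1]

theorem isStatic_cup {i : ℕ} (hi : i % 2 = 0) : (Slice.cup i).IsStatic := by
  intro x t
  refine ⟨rfl, ?_⟩
  funext j
  simp [regionFun, hi]

theorem isStatic_cap {i : ℕ} (hi : i % 2 = 1) : (Slice.cap i).IsStatic := by
  intro x t
  exact ⟨by simp [energyFun, hi], rfl⟩

theorem isStatic_crossing (c : Crossing) {i : ℕ} (hi : i % 2 = 0) :
    (Slice.crossing c i).IsStatic := by
  intro x t
  refine ⟨by simp [energyFun, hi], ?_⟩
  funext j
  simp [regionFun, hi]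

end States

/-! ### Exchange of distant slices. -/

section Moves

theorem regionFun_cup_even (k : ℕ) (x : ℕ → ℝ) (t : ℝ) :
    regionFun (.cup (2 * k)) x t = fun j => if j ≤ k then x j else x (j - 1) := by
  funext j
  simp [regionFun]

theorem regionFun_cup_odd (k : ℕ) (x : ℕ → ℝ) (t : ℝ) :
    regionFun (.cup (2 * k + 1)) x t =
      fun j => if j ≤ k then x j else if j = k + 1 then t else x (j - 1) := by
  funext j
  simp [regionFun, show (2 * k + 1) / 2 = k by omega, show (2 * k + 1) % 2 = 1 by omega]

theorem regionFun_cap_even (k : ℕ) (x : ℕ → ℝ) (t : ℝ) :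
    regionFun (.cap (2 * k)) x t = fun j => if j ≤ k then x j else x (j + 1) := by
  funext j
  simp [regionFun]

theorem regionFun_cap_odd (k : ℕ) (x : ℕ → ℝ) (t : ℝ) :
    regionFun (.cap (2 * k + 1)) x t = fun j => if j ≤ k then x j else x (j + 1) := by
  funext j
  simp [regionFun, show (2 * k + 1) / 2 = k by omega]

theorem regionFun_crossing_even (c : Crossing) (k : ℕ) (x : ℕ → ℝ) (t : ℝ) :
    regionFun (.crossing c (2 * k)) x t = x := by
  funext j
  simp [regionFun]

theorem regionFun_crossing_odd (c : Crossing) (k : ℕ) (x : ℕ → ℝ) (t : ℝ) :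
    regionFun (.crossing c (2 * k + 1)) x t = fun j => if j = k + 1 then t else x j := by
  funext j
  simp [regionFun, show (2 * k + 1) / 2 = k by omega, show (2 * k + 1) % 2 = 1 by omega]

theorem energyFun_cup (i : ℕ) (x : ℕ → ℝ) (t : ℝ) : energyFun (.cup i) x t = 0 := rfl

theorem energyFun_cap_even (k : ℕ) (x : ℕ → ℝ) (t : ℝ) :
    energyFun (.cap (2 * k)) x t = t * (x k - x (k + 1)) := by
  simp [energyFun]

theorem energyFun_cap_odd (k : ℕ) (x : ℕ → ℝ) (t : ℝ) :
    energyFun (.cap (2 * k + 1)) x t = 0 := by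
  simp [energyFun, show (2 * k + 1) % 2 = 1 by omega]

theorem energyFun_crossing_even (c : Crossing) (k : ℕ) (x : ℕ → ℝ) (t : ℝ) :
    energyFun (.crossing c (2 * k)) x t = c.weight * (x k - x (k + 1)) ^ 2 := by
  simp [energyFun]

theorem energyFun_crossing_odd (c : Crossing) (k : ℕ) (x : ℕ → ℝ) (t : ℝ) :
    energyFun (.crossing c (2 * k + 1)) x t = -c.weight * (x (k + 1) - t) ^ 2 := by
  simp [energyFun, show (2 * k + 1) / 2 = k by omega, show (2 * k + 1) % 2 = 1 by omega]

/-- At a maximum that merges two regions, they have the same value. -/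
def Slice.IsMerging (p : Slice) (x : ℕ → ℝ) : Prop :=
  ∀ i, p = .cap i → i % 2 = 0 → x (i / 2) = x (i / 2 + 1)

/-- The merging condition matters for a maximum `p` with an even number of strands to its left:
above it only one of the two merged values is kept, while below it `r` may use the other one. -/
theorem regionFun_exchange (p r : Slice) (x : ℕ → ℝ) (s t : ℝ) (hp : p.IsMerging x) :
    regionFun (r.shift (p.pos + p.outs)) (regionFun p x s) t =
      regionFun p (regionFun (r.shift (p.pos + p.ins)) x t) s := by
  funext j
  have h1 : ∀ a b : ℕ, (a + 2 + b) / 2 = (a + b) / 2 + 1 := by omega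
  have h2 : ∀ a b : ℕ, (a + 2 + b) % 2 = (a + b) % 2 := by omega
  have h3 : ∀ a b : ℕ, a / 2 ≤ (a + b) / 2 := by omega
  have h4 : ∀ a b : ℕ, a / 2 = (a + b) / 2 → a % 2 = 1 → (a + b) % 2 = 1 := by omega
  have h5 : ∀ a : ℕ, a % 2 = 0 ∨ a % 2 = 1 := by omega
  have hp' := fun i (h : p = .cap i) => hp i h
  clear hp
  rcases p with i | i | ⟨c, i⟩ <;> rcases r with l | l | ⟨d, l⟩ <;>
    simp only [regionFun, Slice.shift, Slice.pos, Slice.ins, Slice.outs, h1, h2, add_zero] <;>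
    simp only [reduceCtorEq, false_imp_iff, Slice.cap.injEq, forall_eq', implies_true] at hp' <;>
    replace h3 := h3 i l <;> replace h4 := h4 i l <;> clear h1 h2 <;>
    have h6 := h5 i <;> replace h5 := h5 (i + l) <;>
    generalize (i + l) / 2 = m at * <;> generalize (i + l) % 2 = m' at * <;>
    generalize i / 2 = n at * <;> generalize i % 2 = n' at * <;>
    grind

theorem energyFun_exchange_left (p r : Slice) (x : ℕ → ℝ) (s t : ℝ) (hp : p.IsMerging x) :
    energyFun (r.shift (p.pos + p.outs)) (regionFun p x s) t =
      energyFun (r.shift (p.pos + p.ins)) x t := by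
  have h1 : ∀ a b : ℕ, (a + 2 + b) / 2 = (a + b) / 2 + 1 := by omega
  have h2 : ∀ a b : ℕ, (a + 2 + b) % 2 = (a + b) % 2 := by omega
  have h3 : ∀ a b : ℕ, a / 2 ≤ (a + b) / 2 := by omega
  have h4 : ∀ a b : ℕ, a / 2 = (a + b) / 2 → a % 2 = 1 → (a + b) % 2 = 1 := by omega
  have h5 : ∀ a : ℕ, a % 2 = 0 ∨ a % 2 = 1 := by omega
  have hp' := fun i (h : p = .cap i) => hp i h
  clear hp
  rcases p with i | i | ⟨c, i⟩ <;> rcases r with l | l | ⟨d, l⟩ <;>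
    simp only [energyFun, regionFun, Slice.shift, Slice.pos, Slice.ins, Slice.outs, h1, h2, add_zero] <;>
    simp only [reduceCtorEq, false_imp_iff, Slice.cap.injEq, forall_eq', implies_true] at hp' <;>
    replace h3 := h3 i l <;> replace h4 := h4 i l <;> clear h1 h2 <;>
    have h6 := h5 i <;> replace h5 := h5 (i + l) <;>
    generalize (i + l) / 2 = m at * <;> generalize (i + l) % 2 = m' at * <;>
    generalize i / 2 = n at * <;> generalize i % 2 = n' at * <;>
    grind

theorem energyFun_exchange_right (p r : Slice) (x : ℕ → ℝ) (s t : ℝ) :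
    energyFun p (regionFun (r.shift (p.pos + p.ins)) x t) s = energyFun p x s := by
  have h1 : ∀ a b : ℕ, (a + 2 + b) / 2 = (a + b) / 2 + 1 := by omega
  have h2 : ∀ a b : ℕ, (a + 2 + b) % 2 = (a + b) % 2 := by omega
  have h3 : ∀ a b : ℕ, a / 2 ≤ (a + b) / 2 := by omega
  have h4 : ∀ a b : ℕ, a / 2 = (a + b) / 2 → a % 2 = 1 → (a + b) % 2 = 1 := by omega
  have h5 : ∀ a : ℕ, a % 2 = 0 ∨ a % 2 = 1 := by omega
  rcases p with i | i | ⟨c, i⟩ <;> rcases r with l | l | ⟨d, l⟩ <;>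
    simp only [energyFun, regionFun, Slice.shift, Slice.pos, Slice.ins, h1, h2] <;>
    replace h3 := h3 i l <;> replace h4 := h4 i l <;> clear h1 h2 <;>
    have h6 := h5 i <;> replace h5 := h5 (i + l) <;>
    generalize (i + l) / 2 = m at * <;> generalize (i + l) % 2 = m' at * <;>
    generalize i / 2 = n at * <;> generalize i % 2 = n' at * <;>
    grind

variable {E : Type} [AddCommGroup E] [Module ℝ E]

/-- The exchange of the last two coordinates. -/
def swapLast (E : Type) [AddCommGroup E] [Module ℝ E] : ((E × ℝ) × ℝ) ≃ₗ[ℝ] ((E × ℝ) × ℝ) where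
  toFun z := ((z.1.1, z.2), z.1.2)
  invFun z := ((z.1.1, z.2), z.1.2)
  map_add' _ _ := rfl
  map_smul' _ _ := rfl
  left_inv _ := rfl
  right_inv _ := rfl

/-- The value of a region as a linear form. -/
def coordinate (φ : E →ₗ[ℝ] (ℕ → ℝ)) (k : ℕ) : E →ₗ[ℝ] ℝ := LinearMap.proj k ∘ₗ φ

@[simp]
theorem coordinate_apply (φ : E →ₗ[ℝ] (ℕ → ℝ)) (k : ℕ) (e : E) : coordinate φ k e = φ e k := rfl

variable [FiniteDimensional ℝ E] (q : QuadraticForm ℝ E) (φ : E →ₗ[ℝ] (ℕ → ℝ)) (w : List Slice)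

/-- The multiplier direction is isotropic, and its orthogonal complement consists of the vectors
whose `E`-part satisfies `l = 0`. Reducing along it therefore imposes the constraint without a
change of signature. -/
theorem wordSig_eq_of_multiplier (l : E →ₗ[ℝ] ℝ) {q : QuadraticForm ℝ (E × ℝ)}
    {φ : (E × ℝ) →ₗ[ℝ] (ℕ → ℝ)} (hq : ∀ e t, q (e, t) = q (e, 0) + t * l e)
    (hφ : ∀ e t, φ (e, t) = φ (e, 0)) :
    wordSig w (E × ℝ) q φ = wordSig w (LinearMap.ker l)
      (q.comp (LinearMap.inl ℝ E ℝ ∘ₗ (LinearMap.ker l).subtype))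
      (φ ∘ₗ LinearMap.inl ℝ E ℝ ∘ₗ (LinearMap.ker l).subtype) := by
  obtain ⟨pr, hpr⟩ := (LinearMap.ker l).subtype.exists_leftInverse_of_injective
    (LinearMap.ker_eq_bot.2 (LinearMap.ker l).injective_subtype)
  have h0 : q ((0 : E), (1 : ℝ)) = 0 := by
    rw [hq]
    rw [show ((0 : E), (0 : ℝ)) = 0 from rfl, map_zero, zero_add, map_zero, mul_zero]
  have hpol : ∀ e : E × ℝ, polar q ((0 : E), (1 : ℝ)) e = l e.1 := by
    rintro ⟨e, t⟩
    rw [polar, h0, Prod.mk_add_mk, zero_add, hq e (1 + t), hq e t]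
    ring
  have h : Reduction q (q.comp (LinearMap.inl ℝ E ℝ ∘ₗ (LinearMap.ker l).subtype))
      ((0 : E), (1 : ℝ)) (LinearMap.inl ℝ E ℝ ∘ₗ (LinearMap.ker l).subtype)
      (pr ∘ₗ LinearMap.fst ℝ E ℝ) := by
    refine ⟨fun f => ?_, fun f => rfl, fun e he => ⟨e.2, ?_⟩⟩
    · rw [hpol]
      exact f.2
    · rw [hpol] at he
      have : pr e.1 = ⟨e.1, he⟩ := LinearMap.congr_fun hpr ⟨e.1, he⟩
      ext <;> simp [this]
  rw [wordSig_of_reduction w h (ψ := φ ∘ₗ LinearMap.inl ℝ E ℝ ∘ₗ (LinearMap.ker l).subtype) ?_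
    (fun f => rfl), h0]
  · simp
  · rw [hφ]
    exact map_zero φ

theorem wordSig_eq_of_eq_on_ker (l : E →ₗ[ℝ] ℝ) {q q' : QuadraticForm ℝ (E × ℝ)}
    {φ φ' : (E × ℝ) →ₗ[ℝ] (ℕ → ℝ)} (hq : ∀ e t, q (e, t) = q (e, 0) + t * l e)
    (hq' : ∀ e t, q' (e, t) = q' (e, 0) + t * l e) (hφ : ∀ e t, φ (e, t) = φ (e, 0))
    (hφ' : ∀ e t, φ' (e, t) = φ' (e, 0))
    (h : ∀ e, l e = 0 → q (e, 0) = q' (e, 0) ∧ φ (e, 0) = φ' (e, 0)) :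
    wordSig w (E × ℝ) q φ = wordSig w (E × ℝ) q' φ' := by
  rw [wordSig_eq_of_multiplier w l hq hφ, wordSig_eq_of_multiplier w l hq' hφ']
  exact wordSig_congr w (fun e => (h e e.2).1) (fun e => (h e e.2).2)

theorem wordSig_exchange (p r : Slice) :
    wordSig (p :: r.shift (p.pos + p.outs) :: w) E q φ =
      wordSig (r.shift (p.pos + p.ins) :: p :: w) E q φ := by
  -- If `p` merges two regions, the two sides agree only on the hyperplane imposed by its
  -- multiplier. In all other cases, interchanging the two new coordinates identifies them.
  by_cases hp : ∃ k, p = .cap (2 * k)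
  · obtain ⟨k, rfl⟩ := hp
    have hm : ∀ x : ℕ → ℝ, (Slice.cap (2 * k)).IsMerging x ↔ x k = x (k + 1) := by
      intro x
      simp [Slice.IsMerging]
    set p := Slice.cap (2 * k) with hpdef
    have hcap : ∀ x s, energyFun p x s = s * (x k - x (k + 1)) := by
      simp [hpdef, energyFun]
    have hreg : ∀ x s, regionFun p x s = regionFun p x 0 := fun x s => rfl
    let f := (swapLast E)
    let qL := nextForm (r.shift (p.pos + p.outs)) (nextForm p q φ) (nextValues p φ)
    let φL := nextValues (r.shift (p.pos + p.outs)) (nextValues p φ)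
    have h1 : wordSig w _ qL φL = wordSig w _ (qL.comp f.toLinearMap) (φL ∘ₗ f.toLinearMap) := by
      refine wordSig_of_equiv w f ?_ ?_
      · rintro ⟨⟨e, s⟩, t⟩
        rfl
      · rintro ⟨⟨e, s⟩, t⟩
        rfl
    rw [wordSig, wordSig, wordSig, wordSig, h1]
    refine wordSig_eq_of_eq_on_ker w
      ((coordinate φ k - coordinate φ (k + 1)) ∘ₗ LinearMap.fst ℝ E ℝ) ?_ ?_ ?_ ?_ ?_
    · rintro ⟨e, t⟩ s
      simp [qL, f, swapLast, hcap, hreg (φ e) s]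
      ring
    · rintro ⟨e, t⟩ s
      simp only [nextForm_apply, nextValues_apply, energyFun_exchange_right]
      simp [hcap]
    · rintro ⟨e, t⟩ s
      simp [φL, f, swapLast, hreg (φ e) s]
    · rintro ⟨e, t⟩ s
      simp [hreg _ s]
    · rintro ⟨e, t⟩ he
      have he' : p.IsMerging (φ e) := by
        rw [hm]
        simpa [sub_eq_zero] using he
      constructor
      · simp [qL, f, swapLast, energyFun_exchange_left _ _ _ _ _ he', energyFun_exchange_right]
        ring
      · simp [φL, f, swapLast, regionFun_exchange _ _ _ _ _ he']
  · have hm : ∀ x : ℕ → ℝ, p.IsMerging x := by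
      intro x i hi h2
      exact absurd ⟨i / 2, by rw [hi]; congr 1; omega⟩ hp
    refine wordSig_of_equiv w (swapLast E) ?_ ?_
    · rintro ⟨⟨e, s⟩, t⟩
      simp [swapLast, energyFun_exchange_left _ _ _ _ _ (hm _), energyFun_exchange_right]
      ring
    · rintro ⟨⟨e, s⟩, t⟩
      simp [swapLast, regionFun_exchange _ _ _ _ _ (hm _)]

end Moves

/-! ### The Goeritz form under zigzags and turned crossings. -/

section ReidemeisterMoves

variable {E : Type} [AddCommGroup E] [Module ℝ E] (q : QuadraticForm ℝ E) (φ : E →ₗ[ℝ] (ℕ → ℝ))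
  (w : List Slice)

/-- Duplicating the value of a region. -/
def duplicate (k : ℕ) (φ : E →ₗ[ℝ] (ℕ → ℝ)) : E →ₗ[ℝ] (ℕ → ℝ) :=
  nextValues (.cup (2 * k)) φ ∘ₗ LinearMap.inl ℝ E ℝ

@[simp]
theorem duplicate_apply (k : ℕ) (e : E) :
    duplicate k φ e = fun j => if j ≤ k then φ e j else φ e (j - 1) := by
  simp [duplicate, regionFun_cup_even]

/-- Deleting the value of a region. -/
def delete (k : ℕ) (φ : E →ₗ[ℝ] (ℕ → ℝ)) : E →ₗ[ℝ] (ℕ → ℝ) :=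
  nextValues (.cap (2 * k + 1)) φ ∘ₗ LinearMap.inl ℝ E ℝ

@[simp]
theorem delete_apply (k : ℕ) (e : E) :
    delete k φ e = fun j => if j ≤ k then φ e j else φ e (j + 1) := by
  simp [delete, regionFun_cap_odd]

variable [FiniteDimensional ℝ E]

theorem wordSig_of_isotropic {F : Type} [AddCommGroup F] [Module ℝ F] [FiniteDimensional ℝ F]
    {q : QuadraticForm ℝ E} {p : QuadraticForm ℝ F} {φ : E →ₗ[ℝ] (ℕ → ℝ)}
    {ψ : F →ₗ[ℝ] (ℕ → ℝ)} {k : E} {j : F →ₗ[ℝ] E} {pr : E →ₗ[ℝ] F} (h : Reduction q p k j pr)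
    (hq : q k = 0) (hk : φ k = 0) (hj : ∀ f, φ (j f) = ψ f) :
    wordSig w E q φ = wordSig w F p ψ := by
  simp [wordSig_of_reduction w h hk hj, hq]

theorem wordSig_of_anisotropic {F : Type} [AddCommGroup F] [Module ℝ F] [FiniteDimensional ℝ F]
    {q : QuadraticForm ℝ E} {p : QuadraticForm ℝ F} {φ : E →ₗ[ℝ] (ℕ → ℝ)}
    {ψ : F →ₗ[ℝ] (ℕ → ℝ)} {k : E} {j : F →ₗ[ℝ] E} {pr : E →ₗ[ℝ] F} (h : Reduction q p k j pr)
    {c : ℤ} (hc : c = -1 ∨ c = 0 ∨ c = 1) (hq : q k = c) (hk : φ k = 0)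
    (hj : ∀ f, φ (j f) = ψ f) : wordSig w E q φ = wordSig w F p ψ + c := by
  rw [wordSig_of_reduction w h hk hj, hq]
  rcases hc with rfl | rfl | rfl <;> simp

theorem wordSig_crossing_even (c : Crossing) (k : ℕ) :
    wordSig (.crossing c (2 * k) :: w) E q φ = wordSig w E
      (q + linMulLin ((c.weight : ℝ) • (coordinate φ k - coordinate φ (k + 1)))
        (coordinate φ k - coordinate φ (k + 1))) φ := by
  rw [wordSig_cons_of_isStatic (isStatic_crossing c (by omega))]
  refine wordSig_congr w (fun e => ?_) fun e => ?_
  · simp [energyFun_crossing_even]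
    ring
  · simp [regionFun_crossing_even]

theorem wordSig_cup_even (k : ℕ) :
    wordSig (.cup (2 * k) :: w) E q φ = wordSig w E q (duplicate k φ) := by
  rw [wordSig_cons_of_isStatic (isStatic_cup (by omega))]
  refine wordSig_congr w (fun e => ?_) fun e => rfl
  simp [energyFun_cup]

theorem wordSig_cap_odd (k : ℕ) :
    wordSig (.cap (2 * k + 1) :: w) E q φ = wordSig w E q (delete k φ) := by
  rw [wordSig_cons_of_isStatic (isStatic_cap (by omega))]
  refine wordSig_congr w (fun e => ?_) fun e => rfl
  simp [energyFun_cap_odd]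

/-- For even `i` a value is duplicated and deleted again. For odd `i` the minimum starts a new
region, and the multiplier of the maximum forces it to have the value of its right neighbour; both
coordinates cancel as a hyperbolic pair. -/
theorem wordSig_zigzagLeft (i : ℕ) :
    wordSig (.cup i :: .cap (i + 1) :: w) E q φ = wordSig w E q φ := by
  obtain ⟨k, rfl | rfl⟩ := i.even_or_odd'
  · rw [wordSig_cup_even, wordSig_cap_odd]
    refine wordSig_congr w (fun e => rfl) fun e => ?_
    funext j
    simp only [delete_apply, duplicate_apply]
    grind
  · rw [show 2 * k + 1 + 1 = 2 * (k + 1) by ring, wordSig, wordSig]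
    refine wordSig_of_isotropic w (k := ((0, 0), 1))
      (j := (LinearMap.id.prod (coordinate φ (k + 1))).prod 0)
      (pr := LinearMap.fst ℝ E ℝ ∘ₗ LinearMap.fst ℝ (E × ℝ) ℝ) ?_ ?_ ?_ ?_
    · constructor
      · intro f
        simp [polar, energyFun_cup, energyFun_cap_even, regionFun_cup_odd]
      · intro f
        simp [energyFun_cup, energyFun_cap_even]
      · rintro ⟨⟨e, s⟩, t⟩ he
        simp [polar, energyFun_cup, energyFun_cap_even, regionFun_cup_odd] at he
        refine ⟨t, ?_⟩
        ext <;> simp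
        linarith
    · simp [energyFun_cup, energyFun_cap_even, regionFun_cup_odd]
    · funext j
      simp [regionFun_cup_odd, regionFun_cap_even]
    · intro f
      funext j
      simp only [nextValues_apply, regionFun_cup_odd, regionFun_cap_even]
      simp
      grind

theorem wordSig_zigzagRight (i : ℕ) :
    wordSig (.cup (i + 1) :: .cap i :: w) E q φ = wordSig w E q φ := by
  obtain ⟨k, rfl | rfl⟩ := i.even_or_odd'
  · rw [wordSig, wordSig]
    refine wordSig_of_isotropic w (k := ((0, 0), 1))
      (j := (LinearMap.id.prod (coordinate φ k)).prod 0)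
      (pr := LinearMap.fst ℝ E ℝ ∘ₗ LinearMap.fst ℝ (E × ℝ) ℝ) ?_ ?_ ?_ ?_
    · constructor
      · intro f
        simp [polar, energyFun_cup, energyFun_cap_even, regionFun_cup_odd]
      · intro f
        simp [energyFun_cup, energyFun_cap_even]
      · rintro ⟨⟨e, s⟩, t⟩ he
        simp [polar, energyFun_cup, energyFun_cap_even, regionFun_cup_odd] at he
        refine ⟨t, ?_⟩
        ext <;> simp
        linarith
    · simp [energyFun_cup, energyFun_cap_even, regionFun_cup_odd]
    · funext j
      simp [regionFun_cup_odd, regionFun_cap_even]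
    · intro f
      funext j
      simp only [nextValues_apply, regionFun_cup_odd, regionFun_cap_even]
      simp
      grind
  · rw [show 2 * k + 1 + 1 = 2 * (k + 1) by ring, wordSig_cup_even, wordSig_cap_odd]
    refine wordSig_congr w (fun e => rfl) fun e => ?_
    funext j
    simp only [delete_apply, duplicate_apply]
    grind

theorem wordSig_turnCup (c : Crossing) (i : ℕ) :
    wordSig (.cup i :: .crossing c (i + 1) :: w) E q φ =
      wordSig (.cup (i + 1) :: .crossing c.switch i :: w) E q φ := by
  obtain ⟨k, rfl | rfl⟩ := i.even_or_odd'
  · rw [wordSig_cup_even, wordSig, wordSig, wordSig_crossing_even]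
    refine wordSig_congr w (fun e => ?_) fun e => ?_
    · simp [energyFun_cup, energyFun_crossing_odd, regionFun_cup_odd, Crossing.weight_switch]
      ring
    · funext j
      simp only [nextValues_apply, regionFun_crossing_odd, regionFun_cup_odd, duplicate_apply]
      grind
  · rw [show 2 * k + 1 + 1 = 2 * (k + 1) by ring, wordSig_cup_even, wordSig,
      wordSig_crossing_even, wordSig]
    refine wordSig_congr w (fun e => ?_) fun e => ?_
    · simp [energyFun_cup, energyFun_crossing_odd, regionFun_cup_odd, Crossing.weight_switch]
      ring
    · funext j
      simp only [nextValues_apply, regionFun_crossing_odd, regionFun_cup_odd, duplicate_apply]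
      grind

/-- The region that starts above the crossing is at once merged with its neighbour `m`, to the left
or right according to `h`. Eliminating the multiplier replaces the new variable by the value of
region `m`. -/
theorem wordSig_crossing_odd_cap_even (c : Crossing) (k : ℕ) (q : QuadraticForm ℝ E)
    (ψ : E →ₗ[ℝ] (ℕ → ℝ)) (p : QuadraticForm ℝ E) (n m : ℕ)
    (h : n = k ∧ m = k ∨ n = k + 1 ∧ m = k + 2)
    (hp : ∀ e, p e = q e - c.weight * (φ e m - φ e (k + 1)) ^ 2)
    (hψ : ∀ e j, ψ e j = if j ≤ n then if j = k + 1 then φ e m else φ e j else φ e (j + 1)) :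
    wordSig (.crossing c (2 * k + 1) :: .cap (2 * n) :: w) E q φ = wordSig w E p ψ := by
  rw [wordSig, wordSig]
  refine wordSig_of_isotropic w (k := ((0, 0), 1))
    (j := (LinearMap.id.prod (coordinate φ m)).prod 0)
    (pr := LinearMap.fst ℝ E ℝ ∘ₗ LinearMap.fst ℝ (E × ℝ) ℝ) ?_ ?_ ?_ ?_
  · constructor
    · intro f
      simp only [polar, nextForm_apply, nextValues_apply, energyFun_crossing_odd,
        energyFun_cap_even, regionFun_crossing_odd]
      simp
      grind
    · intro f
      simp [energyFun_crossing_odd, energyFun_cap_even, hp]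
      ring
    · rintro ⟨⟨e, s⟩, t⟩ he
      refine ⟨t, ?_⟩
      have : s = φ e m := by
        simp only [polar, nextForm_apply, nextValues_apply, energyFun_crossing_odd,
          energyFun_cap_even, regionFun_crossing_odd] at he
        simp at he
        grind
      ext <;> simp [this]
  · simp [energyFun_cap_even, energyFun_crossing_odd, regionFun_crossing_odd]
  · funext j
    simp [regionFun_crossing_odd, regionFun_cap_even]
  · intro f
    funext j
    simp only [nextValues_apply, regionFun_crossing_odd, regionFun_cap_even, hψ]
    simp
    grind

theorem wordSig_turnCap (c : Crossing) (i : ℕ) :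
    wordSig (.crossing c (i + 1) :: .cap i :: w) E q φ =
      wordSig (.crossing c.switch i :: .cap (i + 1) :: w) E q φ := by
  obtain ⟨k, rfl | rfl⟩ := i.even_or_odd'
  · rw [wordSig_crossing_even, wordSig_cap_odd]
    refine wordSig_crossing_odd_cap_even φ w c k q _ _ k k (Or.inl ⟨rfl, rfl⟩) ?_ ?_
    · intro e
      simp [Crossing.weight_switch]
      ring
    · intro e j
      simp only [delete_apply]
      grind
  · rw [show 2 * k + 1 + 1 = 2 * (k + 1) by ring, wordSig_crossing_even, wordSig_cap_odd]
    symm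
    refine wordSig_crossing_odd_cap_even φ w c.switch k q _ _ (k + 1) (k + 2) (Or.inr ⟨rfl, rfl⟩) ?_ ?_
    · intro e
      simp [Crossing.weight_switch]
      ring
    · intro e j
      simp only [delete_apply]
      grind

end ReidemeisterMoves

/-! ### The Goeritz form under the classical Reidemeister moves. -/

section TriangleMove

variable {E : Type} [AddCommGroup E] [Module ℝ E] [FiniteDimensional ℝ E]
  (q : QuadraticForm ℝ E) (φ : E →ₗ[ℝ] (ℕ → ℝ)) (w : List Slice)

/-- The sign of a crossing with respect to the colouring of the regions with an even number of
strands to their left, if the crossing is between two strands of opposite directions in a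
slice with an odd number of strands to the left of the crossing. -/
def oddWeight (c : Crossing) (i : ℕ) : ℤ := if i % 2 = 1 then -c.weight else 0

theorem Crossing.neg_weight_cases (c : Crossing) :
    -c.weight = -1 ∨ -c.weight = 0 ∨ -c.weight = 1 := by
  cases c <;> simp [Crossing.weight]

/-- For even `i` the crossing compares two copies of one value and has no energy. For odd `i` the
region below it is a leaf: its variable occurs in a single square, with coefficient `-c.weight`,
which splits off. -/
theorem wordSig_r1Cup (c : Crossing) (i : ℕ) :
    wordSig (.cup i :: .crossing c i :: w) E q φ =
      wordSig (.cup i :: w) E q φ + oddWeight c i := by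
  obtain ⟨k, rfl | rfl⟩ := i.even_or_odd'
  · rw [wordSig_cup_even, wordSig_cup_even, wordSig_crossing_even]
    simp only [oddWeight, show ¬ (2 * k % 2 = 1) by omega, if_false, add_zero]
    refine wordSig_congr w (fun e => ?_) fun e => rfl
    simp
  · simp only [oddWeight, show (2 * k + 1) % 2 = 1 by omega, if_true]
    rw [wordSig, wordSig, wordSig]
    refine wordSig_of_anisotropic w (k := ((0, 1), 0))
      (j := LinearMap.id.prod (LinearMap.snd ℝ E ℝ))
      (pr := (LinearMap.fst ℝ E ℝ ∘ₗ LinearMap.fst ℝ (E × ℝ) ℝ).prod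
        (LinearMap.snd ℝ (E × ℝ) ℝ)) ?_ c.neg_weight_cases ?_ ?_ ?_
    · constructor
      · rintro ⟨e, t⟩
        simp [polar, energyFun_cup, energyFun_crossing_odd, regionFun_cup_odd]
      · rintro ⟨e, t⟩
        simp [energyFun_cup, energyFun_crossing_odd, regionFun_cup_odd]
      · rintro ⟨⟨e, s⟩, t⟩ -
        refine ⟨s - t, ?_⟩
        ext <;> simp
    · simp [energyFun_cup, energyFun_crossing_odd, regionFun_cup_odd]
    · funext j
      simp [regionFun_cup_odd, regionFun_crossing_odd]
      grind
    · rintro ⟨e, t⟩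
      funext j
      simp [regionFun_cup_odd, regionFun_crossing_odd]
      grind

theorem wordSig_r1Cap (c : Crossing) (i : ℕ) :
    wordSig (.crossing c i :: .cap i :: w) E q φ =
      wordSig (.cap i :: w) E q φ + oddWeight c i := by
  obtain ⟨k, rfl | rfl⟩ := i.even_or_odd'
  · simp only [oddWeight, show ¬ (2 * k % 2 = 1) by omega, if_false, add_zero]
    rw [wordSig_crossing_even, wordSig, wordSig]
    refine wordSig_eq_of_eq_on_ker w (coordinate φ k - coordinate φ (k + 1)) ?_ ?_ ?_ ?_ ?_
    · intro e t
      simp [energyFun_cap_even]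
    · intro e t
      simp [energyFun_cap_even]
    · intro e t
      simp [regionFun_cap_even]
    · intro e t
      simp [regionFun_cap_even]
    · intro e he
      simp at he
      simp [energyFun_cap_even, he]
  · simp only [oddWeight, show (2 * k + 1) % 2 = 1 by omega, if_true]
    rw [wordSig, wordSig_cap_odd, wordSig_cap_odd]
    refine wordSig_of_anisotropic w (k := (0, 1))
      (j := LinearMap.id.prod (coordinate φ (k + 1)))
      (pr := LinearMap.fst ℝ E ℝ) ?_ c.neg_weight_cases ?_ ?_ ?_
    · constructor
      · intro e
        simp [polar, energyFun_crossing_odd]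
      · intro e
        simp [energyFun_crossing_odd]
      · rintro ⟨e, t⟩ -
        refine ⟨t - φ e (k + 1), ?_⟩
        ext <;> simp
    · simp [energyFun_crossing_odd]
    · funext j
      simp [regionFun_crossing_odd]
      grind
    · intro e
      funext j
      simp [regionFun_crossing_odd]
      grind

/-- For odd `i` the squares of the variable of the middle region cancel. It occurs only linearly,
and acts as a multiplier that equates the regions above and below. For this the weight must be
nonzero. -/
theorem wordSig_r2 (c : Crossing) (i : ℕ) (hc : c.IsClassical) :
    wordSig (.crossing c i :: .crossing c.switch i :: w) E q φ = wordSig w E q φ := by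
  obtain ⟨k, rfl | rfl⟩ := i.even_or_odd'
  · rw [wordSig_crossing_even, wordSig_crossing_even]
    refine wordSig_congr w (fun e => ?_) fun e => rfl
    simp [Crossing.weight_switch]
  · have hw : (c.weight : ℝ) ≠ 0 := by
      cases c <;> simp_all [Crossing.weight, Crossing.IsClassical]
    rw [wordSig, wordSig]
    refine wordSig_of_isotropic w (k := ((0, 1), 0))
      (j := (LinearMap.id.prod 0).prod (coordinate φ (k + 1)))
      (pr := LinearMap.fst ℝ E ℝ ∘ₗ LinearMap.fst ℝ (E × ℝ) ℝ) ?_ ?_ ?_ ?_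
    · constructor
      · intro e
        simp [polar, energyFun_crossing_odd, regionFun_crossing_odd, Crossing.weight_switch]
        ring
      · intro e
        simp [energyFun_crossing_odd, regionFun_crossing_odd, Crossing.weight_switch]
      · rintro ⟨⟨e, s⟩, t⟩ he
        have h : c.weight * (φ e (k + 1) - t) = 0 := by
          simp [polar, energyFun_crossing_odd, regionFun_crossing_odd,
            Crossing.weight_switch] at he
          linarith
        have ht : φ e (k + 1) = t := by
          rcases mul_eq_zero.1 h with h | h
          · exact absurd h hw
          · linarith
        refine ⟨s, ?_⟩
        ext <;> simp [ht]
    · simp [energyFun_crossing_odd, regionFun_crossing_odd, Crossing.weight_switch]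
    · funext j
      simp [regionFun_crossing_odd]
    · intro e
      funext j
      simp [regionFun_crossing_odd]
      grind

/-- The coefficient of the inner variable of the star in a star-triangle move. -/
def starWeight (c₁₂ c₁₃ c₂₃ : Crossing) : ℤ := c₁₃.weight - c₁₂.weight - c₂₃.weight

/-- This is the star-triangle transformation: completing the square in the centre of the star leaves
the triangle. The coefficient `starWeight` is ±1 in all admissible cases; in the excluded case it
would be ±3. -/
theorem wordSig_r3_even (c₁₂ c₁₃ c₂₃ : Crossing) (k : ℕ) (h₁₂ : c₁₂.IsClassical)
    (h₁₃ : c₁₃.IsClassical) (h₂₃ : c₂₃.IsClassical) (h : ¬ (c₁₂ = c₂₃ ∧ c₁₃ = c₁₂.switch)) :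
    wordSig (triangleAfter c₁₂ c₁₃ c₂₃ (2 * k) ++ w) E q φ =
      wordSig (triangleBefore c₁₂ c₁₃ c₂₃ (2 * k) ++ w) E q φ + starWeight c₁₂ c₁₃ c₂₃ := by
  have hs : starWeight c₁₂ c₁₃ c₂₃ = -1 ∨ starWeight c₁₂ c₁₃ c₂₃ = 0 ∨
      starWeight c₁₂ c₁₃ c₂₃ = 1 := by
    cases c₁₂ <;> cases c₁₃ <;> cases c₂₃ <;>
      simp_all [Crossing.IsClassical, Crossing.switch, starWeight, Crossing.weight]
  simp only [triangleAfter, triangleBefore, List.cons_append, List.nil_append]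
  rw [wordSig, wordSig_crossing_even, wordSig, wordSig_crossing_even, wordSig,
    wordSig_crossing_even]
  refine wordSig_of_anisotropic w (k := ((0, 1), 0))
    -- The middle coordinate is the critical value of the centre. The factor `starWeight` stands for
    -- its own inverse, as it is ±1.
    (j := ((LinearMap.fst ℝ E ℝ).prod ((starWeight c₁₂ c₁₃ c₂₃ : ℝ) •
      ((c₁₃.weight : ℝ) • coordinate φ k ∘ₗ LinearMap.fst ℝ E ℝ
      - (c₂₃.weight : ℝ) • coordinate φ (k + 1) ∘ₗ LinearMap.fst ℝ E ℝ
      - (c₁₂.weight : ℝ) • LinearMap.snd ℝ E ℝ))).prod (LinearMap.snd ℝ E ℝ))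
    (pr := (LinearMap.fst ℝ E ℝ ∘ₗ LinearMap.fst ℝ (E × ℝ) ℝ).prod
      (LinearMap.snd ℝ (E × ℝ) ℝ)) ?_ hs ?_ ?_ ?_
  · constructor
    · rintro ⟨e, t⟩
      simp [polar, energyFun_crossing_odd, regionFun_crossing_odd]
      cases c₁₂ <;> cases c₁₃ <;> cases c₂₃ <;>
        simp_all [Crossing.IsClassical, Crossing.switch, starWeight, Crossing.weight] <;> ring
    · rintro ⟨e, t⟩
      simp [energyFun_crossing_odd, regionFun_crossing_odd]
      cases c₁₂ <;> cases c₁₃ <;> cases c₂₃ <;>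
        simp_all [Crossing.IsClassical, Crossing.switch, starWeight, Crossing.weight] <;> ring
    · rintro ⟨⟨e, s⟩, t⟩ -
      exact ⟨s - starWeight c₁₂ c₁₃ c₂₃ * (c₁₃.weight * φ e k - c₂₃.weight * φ e (k + 1)
        - c₁₂.weight * t), by ext <;> simp⟩
  · simp [energyFun_crossing_odd, regionFun_crossing_odd, starWeight]
    ring
  · funext j
    simp [regionFun_crossing_odd]
  · rintro ⟨e, t⟩
    funext j
    simp [regionFun_crossing_odd]
    grind

/-- At odd places the colours are exchanged, so the star is the side before the move. -/
theorem wordSig_r3_odd (c₁₂ c₁₃ c₂₃ : Crossing) (k : ℕ) (h₁₂ : c₁₂.IsClassical)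
    (h₁₃ : c₁₃.IsClassical) (h₂₃ : c₂₃.IsClassical) (h : ¬ (c₁₂ = c₂₃ ∧ c₁₃ = c₁₂.switch)) :
    wordSig (triangleBefore c₁₂ c₁₃ c₂₃ (2 * k + 1) ++ w) E q φ =
      wordSig (triangleAfter c₁₂ c₁₃ c₂₃ (2 * k + 1) ++ w) E q φ + starWeight c₁₂ c₁₃ c₂₃ := by
  have hs : starWeight c₁₂ c₁₃ c₂₃ = -1 ∨ starWeight c₁₂ c₁₃ c₂₃ = 0 ∨
      starWeight c₁₂ c₁₃ c₂₃ = 1 := by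
    cases c₁₂ <;> cases c₁₃ <;> cases c₂₃ <;>
      simp_all [Crossing.IsClassical, Crossing.switch, starWeight, Crossing.weight]
  simp only [triangleAfter, triangleBefore, List.cons_append, List.nil_append,
    show 2 * k + 1 + 1 = 2 * (k + 1) by ring]
  rw [wordSig, wordSig_crossing_even, wordSig, wordSig_crossing_even, wordSig,
    wordSig_crossing_even]
  refine wordSig_of_anisotropic w (k := ((0, 1), 0))
    (j := ((LinearMap.fst ℝ E ℝ).prod ((starWeight c₁₂ c₁₃ c₂₃ : ℝ) •
      ((c₁₃.weight : ℝ) • coordinate φ (k + 2) ∘ₗ LinearMap.fst ℝ E ℝ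
      - (c₁₂.weight : ℝ) • coordinate φ (k + 1) ∘ₗ LinearMap.fst ℝ E ℝ
      - (c₂₃.weight : ℝ) • LinearMap.snd ℝ E ℝ))).prod (LinearMap.snd ℝ E ℝ))
    (pr := (LinearMap.fst ℝ E ℝ ∘ₗ LinearMap.fst ℝ (E × ℝ) ℝ).prod
      (LinearMap.snd ℝ (E × ℝ) ℝ)) ?_ hs ?_ ?_ ?_
  · constructor
    · rintro ⟨e, t⟩
      simp [polar, energyFun_crossing_odd, regionFun_crossing_odd]
      cases c₁₂ <;> cases c₁₃ <;> cases c₂₃ <;>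
        simp_all [Crossing.IsClassical, Crossing.switch, starWeight, Crossing.weight] <;> ring
    · rintro ⟨e, t⟩
      simp [energyFun_crossing_odd, regionFun_crossing_odd]
      cases c₁₂ <;> cases c₁₃ <;> cases c₂₃ <;>
        simp_all [Crossing.IsClassical, Crossing.switch, starWeight, Crossing.weight] <;> ring
    · rintro ⟨⟨e, s⟩, t⟩ -
      exact ⟨s - starWeight c₁₂ c₁₃ c₂₃ * (c₁₃.weight * φ e (k + 2) - c₁₂.weight * φ e (k + 1)
        - c₂₃.weight * t), by ext <;> simp⟩
  · simp [energyFun_crossing_odd, regionFun_crossing_odd, starWeight]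
    ring
  · funext j
    simp [regionFun_crossing_odd]
  · rintro ⟨e, t⟩
    funext j
    simp [regionFun_crossing_odd]
    grind

end TriangleMove

/-! ### Orientations and the correction term. -/

section Orientations

/-- The directions (`true` for upwards) of the strands above a minimum. -/
def insertPair (a : ℕ → Bool) (i : ℕ) (b : Bool) : ℕ → Bool :=
  fun j => if j < i then a j else if j = i then b else if j = i + 1 then !b else a (j - 2)

/-- The directions of the strands above a maximum. -/
def removePair (a : ℕ → Bool) (i : ℕ) : ℕ → Bool := fun j => if j < i then a j else a (j + 2)

/-- The directions of the strands above a crossing. -/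
def swapPair (a : ℕ → Bool) (i : ℕ) : ℕ → Bool :=
  fun j => if j = i then a (i + 1) else if j = i + 1 then a i else a j

/-- The contribution of a crossing to the correction term of the Goeritz form; `s` tells whether
the strands have the same direction. -/
def correction (c : Crossing) (i : ℕ) (s : Bool) : ℤ :=
  if i % 2 = 0 then (if s then c.weight else 0) else (if s then 0 else -c.weight)

/-- The slices have an orientation with the directions `a` at the bottom and `a'` at the top whose
correction term is `μ`. -/
def Oriented : List Slice → (ℕ → Bool) → (ℕ → Bool) → ℤ → Prop
  | [], a, a', μ => a = a' ∧ μ = 0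
  | .cup i :: w, a, a', μ => ∃ b, Oriented w (insertPair a i b) a' μ
  | .cap i :: w, a, a', μ => a i ≠ a (i + 1) ∧ Oriented w (removePair a i) a' μ
  | .crossing c i :: w, a, a', μ =>
      Oriented w (swapPair a i) a' (μ - correction c i (a i == a (i + 1)))

theorem oriented_append (u v : List Slice) (a a'' : ℕ → Bool) (μ : ℤ) :
    Oriented (u ++ v) a a'' μ ↔ ∃ a' ν, Oriented u a a' ν ∧ Oriented v a' a'' (μ - ν) := by
  induction u generalizing a μ with
  | nil => simp [Oriented]
  | cons p u ih =>
    rcases p with i | i | ⟨c, i⟩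
    · simp only [List.cons_append, Oriented, ih]
      grind
    · simp only [List.cons_append, Oriented, ih]
      grind
    · simp only [List.cons_append, Oriented, ih]
      constructor
      · rintro ⟨a', ν, h1, h2⟩
        exact ⟨a', ν + correction c i (a i == a (i + 1)), by simpa using h1, by
          convert h2 using 1; ring⟩
      · rintro ⟨a', ν, h1, h2⟩
        exact ⟨a', _, h1, by convert h2 using 1; ring⟩

theorem oriented_exchange (p r : Slice) (a a' : ℕ → Bool) (μ : ℤ) :
    Oriented [p, r.shift (p.pos + p.outs)] a a' μ ↔
      Oriented [r.shift (p.pos + p.ins), p] a a' μ := by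
  have hc : ∀ c i l s, correction c (i + 2 + l) s = correction c (i + l) s := by
    intro c i l s
    simp [correction, show (i + 2 + l) % 2 = (i + l) % 2 by omega]
  rcases p with i | i | ⟨c, i⟩ <;> rcases r with l | l | ⟨d, l⟩ <;>
    simp only [Slice.shift, Slice.pos, Slice.ins, Slice.outs, Oriented, add_zero, hc]
  · have : ∀ b b', insertPair (insertPair a i b) (i + 2 + l) b' =
        insertPair (insertPair a (i + l) b') i b := by
      intro b b'; funext j; simp only [insertPair]; split_ifs <;> first | rfl | omega
    simp only [this]
    exact exists_comm
  · have : ∀ b, removePair (insertPair a i b) (i + 2 + l) =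
        insertPair (removePair a (i + l)) i b := by
      intro b; funext j; grind [insertPair, removePair]
    simp only [this]
    grind [insertPair]
  · have : ∀ b, swapPair (insertPair a i b) (i + 2 + l) =
        insertPair (swapPair a (i + l)) i b := by
      intro b; funext j; grind [insertPair, swapPair]
    simp only [this]
    grind [insertPair]
  · have : ∀ b, insertPair (removePair a i) (i + l) b =
        removePair (insertPair a (i + 2 + l) b) i := by
      intro b; funext j; grind [insertPair, removePair]
    simp only [this]
    grind [insertPair]
  · have : removePair (removePair a i) (i + l) = removePair (removePair a (i + 2 + l)) i := by
      funext j; grind [removePair]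
    simp only [this]
    grind [removePair]
  · have : swapPair (removePair a i) (i + l) = removePair (swapPair a (i + 2 + l)) i := by
      funext j; grind [swapPair, removePair]
    simp only [this]
    grind [removePair, swapPair]
  · have : ∀ b, insertPair (swapPair a i) (i + 2 + l) b =
        swapPair (insertPair a (i + 2 + l) b) i := by
      intro b; funext j; grind [insertPair, swapPair]
    simp only [this]
    grind [insertPair]
  · have : removePair (swapPair a i) (i + 2 + l) = swapPair (removePair a (i + 2 + l)) i := by
      funext j; grind [removePair, swapPair]
    simp only [this]
    grind [removePair, swapPair]
  · have : swapPair (swapPair a i) (i + 2 + l) = swapPair (swapPair a (i + 2 + l)) i := by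
      funext j; grind [swapPair]
    simp only [this]
    have h1 : swapPair a i (i + 2 + l) = a (i + 2 + l) := by grind [swapPair]
    have h2 : swapPair a i (i + 2 + l + 1) = a (i + 2 + l + 1) := by grind [swapPair]
    have h3 : swapPair a (i + 2 + l) i = a i := by grind [swapPair]
    have h4 : swapPair a (i + 2 + l) (i + 1) = a (i + 1) := by grind [swapPair]
    rw [h1, h2, h3, h4]
    constructor <;> rintro ⟨h, h'⟩ <;> exact ⟨h, by linarith⟩

theorem oriented_zigzagLeft (i : ℕ) (a a' : ℕ → Bool) (μ : ℤ) :
    Oriented [.cup i, .cap (i + 1)] a a' μ ↔ Oriented [] a a' μ := by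
  simp only [Oriented]
  have h : ∀ b, insertPair a i b (i + 1) = !b := by intro b; grind [insertPair]
  have h' : ∀ b, insertPair a i b (i + 1 + 1) = a i := by intro b; grind [insertPair]
  have h2 : removePair (insertPair a i (a i)) (i + 1) = a := by
    funext j; grind [insertPair, removePair]
  constructor
  · rintro ⟨b, hb, hr⟩
    rw [h, h'] at hb
    obtain rfl : b = a i := by grind
    rwa [h2] at hr
  · intro hr
    refine ⟨a i, ?_, by rwa [h2]⟩
    rw [h, h']
    grind

theorem oriented_zigzagRight (i : ℕ) (a a' : ℕ → Bool) (μ : ℤ) :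
    Oriented [.cup (i + 1), .cap i] a a' μ ↔ Oriented [] a a' μ := by
  simp only [Oriented]
  have h : ∀ b, insertPair a (i + 1) b i = a i := by intro b; grind [insertPair]
  have h' : ∀ b, insertPair a (i + 1) b (i + 1) = b := by intro b; grind [insertPair]
  have h2 : removePair (insertPair a (i + 1) (!a i)) i = a := by
    funext j; grind [insertPair, removePair]
  constructor
  · rintro ⟨b, hb, hr⟩
    rw [h, h'] at hb
    obtain rfl : b = !a i := by revert hb; cases a i <;> cases b <;> simp
    rwa [h2] at hr
  · intro hr
    refine ⟨!a i, ?_, by rwa [h2]⟩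
    rw [h, h']
    grind

/-- A crossing turned by a minimum or maximum moves to a place of the other parity, has its type
switched, and has exactly one strand reversed; the three effects cancel. -/
theorem correction_succ (c : Crossing) (i : ℕ) (s : Bool) :
    correction c (i + 1) s = correction c.switch i (!s) := by
  rcases Nat.mod_two_eq_zero_or_one i with h | h
  · have : (i + 1) % 2 = 1 := by omega
    cases s <;> simp [correction, h, this, Crossing.weight_switch]
  · have : (i + 1) % 2 = 0 := by omega
    cases s <;> simp [correction, h, this, Crossing.weight_switch]

theorem oriented_turnCup (c : Crossing) (i : ℕ) (a a' : ℕ → Bool) (μ : ℤ) :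
    Oriented [.cup i, .crossing c (i + 1)] a a' μ ↔
      Oriented [.cup (i + 1), .crossing c.switch i] a a' μ := by
  simp only [Oriented, correction_succ]
  refine exists_congr fun b => ?_
  have h : swapPair (insertPair a i b) (i + 1) = swapPair (insertPair a (i + 1) b) i := by
    funext j; grind [insertPair, swapPair]
  have h1 : (!(insertPair a i b (i + 1) == insertPair a i b (i + 1 + 1))) =
      (insertPair a (i + 1) b i == insertPair a (i + 1) b (i + 1)) := by
    have k1 : insertPair a i b (i + 1) = !b := by grind [insertPair]
    have k2 : insertPair a i b (i + 1 + 1) = a i := by grind [insertPair]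
    have k3 : insertPair a (i + 1) b i = a i := by grind [insertPair]
    have k4 : insertPair a (i + 1) b (i + 1) = b := by grind [insertPair]
    rw [k1, k2, k3, k4]
    cases b <;> cases a i <;> rfl
  rw [h, h1]

theorem oriented_turnCap (c : Crossing) (i : ℕ) (a a' : ℕ → Bool) (μ : ℤ) :
    Oriented [.crossing c (i + 1), .cap i] a a' μ ↔
      Oriented [.crossing c.switch i, .cap (i + 1)] a a' μ := by
  simp only [Oriented, correction_succ]
  have h : removePair (swapPair a (i + 1)) i = removePair (swapPair a i) (i + 1) := by
    funext j; grind [removePair, swapPair]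
  have h1 : swapPair a (i + 1) i = a i := by grind [swapPair]
  have h2 : swapPair a (i + 1) (i + 1) = a (i + 2) := by grind [swapPair]
  have h3 : swapPair a i (i + 1) = a i := by grind [swapPair]
  have h4 : swapPair a i (i + 1 + 1) = a (i + 2) := by grind [swapPair]
  rw [h, h1, h2, h3, h4]
  refine and_congr_right fun h => ?_
  have h5 : (!(a (i + 1) == a (i + 1 + 1))) = (a i == a (i + 1)) := by
    revert h
    generalize a i = x, a (i + 1) = y, a (i + 2) = z
    revert x y z
    decide
  rw [h5]

theorem correction_false (c : Crossing) (i : ℕ) : correction c i false = oddWeight c i := by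
  rcases Nat.mod_two_eq_zero_or_one i with h | h <;> simp [correction, oddWeight, h]

theorem oriented_r1Cup (c : Crossing) (i : ℕ) (a a' : ℕ → Bool) (μ : ℤ) :
    Oriented [.cup i, .crossing c i] a a' (μ + oddWeight c i) ↔ Oriented [.cup i] a a' μ := by
  simp only [Oriented]
  have h : ∀ b, (insertPair a i b i == insertPair a i b (i + 1)) = false := by
    intro b
    simp [insertPair]
  have h2 : ∀ b, swapPair (insertPair a i b) i = insertPair a i (!b) := by
    intro b; funext j; grind [insertPair, swapPair]
  simp only [h, h2, correction_false, add_sub_cancel_right]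
  constructor <;> rintro ⟨b, hb⟩ <;> exact ⟨!b, by simpa using hb⟩

theorem oriented_r1Cap (c : Crossing) (i : ℕ) (a a' : ℕ → Bool) (μ : ℤ) :
    Oriented [.crossing c i, .cap i] a a' (μ + oddWeight c i) ↔ Oriented [.cap i] a a' μ := by
  simp only [Oriented]
  have h1 : swapPair a i i = a (i + 1) := by grind [swapPair]
  have h2 : swapPair a i (i + 1) = a i := by grind [swapPair]
  have h3 : removePair (swapPair a i) i = removePair a i := by
    funext j; grind [removePair, swapPair]
  rw [h1, h2, h3, ne_comm]
  refine and_congr_right fun h => ?_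
  rw [show (a i == a (i + 1)) = false by simpa using h, correction_false, add_sub_cancel_right]

theorem swapPair_swapPair (a : ℕ → Bool) (i : ℕ) : swapPair (swapPair a i) i = a := by
  funext j; grind [swapPair]

theorem oriented_r2 (c : Crossing) (i : ℕ) (a a' : ℕ → Bool) (μ : ℤ) :
    Oriented [.crossing c i, .crossing c.switch i] a a' μ ↔ Oriented [] a a' μ := by
  simp only [Oriented, swapPair_swapPair]
  have h1 : swapPair a i i = a (i + 1) := by grind [swapPair]
  have h2 : swapPair a i (i + 1) = a i := by grind [swapPair]
  have h3 : ∀ s, correction c.switch i s = -correction c i s := by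
    intro s
    simp only [correction, Crossing.weight_switch]
    split_ifs <;> simp
  rw [h1, h2, h3, Bool.beq_comm]
  simp

/-- Each crossing passes to a place of the other parity. From even to odd its correction drops by
its weight, whatever the directions are, so the sum over the triangle depends only on `starWeight`.
-/
theorem oriented_r3 (c₁₂ c₁₃ c₂₃ : Crossing) (i : ℕ) (a a' : ℕ → Bool) (μ : ℤ) :
    Oriented (triangleAfter c₁₂ c₁₃ c₂₃ i) a a' μ ↔
      Oriented (triangleBefore c₁₂ c₁₃ c₂₃ i) a a'
        (μ - if i % 2 = 0 then starWeight c₁₂ c₁₃ c₂₃ else -starWeight c₁₂ c₁₃ c₂₃) := by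
  simp only [triangleAfter, triangleBefore, Oriented]
  have h : swapPair (swapPair (swapPair a (i + 1)) i) (i + 1) =
      swapPair (swapPair (swapPair a i) (i + 1)) i := by
    funext j; grind [swapPair]
  have h1 : swapPair a i (i + 1) = a i := by grind [swapPair]
  have h2 : swapPair a i (i + 1 + 1) = a (i + 2) := by grind [swapPair]
  have h3 : swapPair (swapPair a i) (i + 1) i = a (i + 1) := by grind [swapPair]
  have h4 : swapPair (swapPair a i) (i + 1) (i + 1) = a (i + 2) := by grind [swapPair]
  have h5 : swapPair a (i + 1) i = a i := by grind [swapPair]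
  have h6 : swapPair a (i + 1) (i + 1) = a (i + 2) := by grind [swapPair]
  have h7 : swapPair (swapPair a (i + 1)) i (i + 1) = a i := by grind [swapPair]
  have h8 : swapPair (swapPair a (i + 1)) i (i + 1 + 1) = a (i + 1) := by grind [swapPair]
  rw [h, h1, h2, h3, h4, h5, h6, h7, h8]
  refine and_congr_right fun _ => ?_
  have h9 : ∀ x : Bool, (x = true) ∨ (x = false) := by decide
  rcases Nat.mod_two_eq_zero_or_one i with hi | hi
  · have : (i + 1) % 2 = 1 := by omega
    simp only [correction, hi, this, starWeight, if_true, one_ne_zero, if_false]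
    grind
  · have : (i + 1) % 2 = 0 := by omega
    simp only [correction, hi, this, starWeight, if_true, one_ne_zero, if_false]
    grind

end Orientations

/-! ### The signature as an invariant of classical links. -/

section Invariance

/-- A move changes the signature of the Goeritz form and the correction term by the same
number. -/
def PreservesSignature (L R : List Slice) : Prop :=
  ∃ s : ℤ,
    (∀ (E : Type) [AddCommGroup E] [Module ℝ E] [FiniteDimensional ℝ E] (q : QuadraticForm ℝ E)
      (φ : E →ₗ[ℝ] (ℕ → ℝ)) (w : List Slice),
      wordSig (L ++ w) E q φ = wordSig (R ++ w) E q φ + s) ∧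
    ∀ a a' μ, Oriented L a a' (μ + s) ↔ Oriented R a a' μ

theorem preservesSignature_of_eq {L R : List Slice}
    (h : ∀ (E : Type) [AddCommGroup E] [Module ℝ E] [FiniteDimensional ℝ E]
      (q : QuadraticForm ℝ E) (φ : E →ₗ[ℝ] (ℕ → ℝ)) (w : List Slice),
      wordSig (L ++ w) E q φ = wordSig (R ++ w) E q φ)
    (h' : ∀ a a' μ, Oriented L a a' μ ↔ Oriented R a a' μ) : PreservesSignature L R :=
  ⟨0, fun E _ _ _ q φ w => by rw [h, add_zero], fun a a' μ => by rw [h', add_zero]⟩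

theorem PlaneIsotopy.preservesSignature {L R : List Slice} (h : PlaneIsotopy L R) :
    PreservesSignature L R := by
  rcases h with ⟨p, r⟩ | ⟨i⟩ | ⟨i⟩ | ⟨c, i⟩ | ⟨c, i⟩
  · exact preservesSignature_of_eq (fun E _ _ _ q φ w => wordSig_exchange q φ w p r)
      (oriented_exchange p r)
  · exact preservesSignature_of_eq (fun E _ _ _ q φ w => wordSig_zigzagLeft q φ w i)
      (oriented_zigzagLeft i)
  · exact preservesSignature_of_eq (fun E _ _ _ q φ w => wordSig_zigzagRight q φ w i)
      (oriented_zigzagRight i)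
  · exact preservesSignature_of_eq (fun E _ _ _ q φ w => wordSig_turnCup q φ w c i)
      (oriented_turnCup c i)
  · exact preservesSignature_of_eq (fun E _ _ _ q φ w => wordSig_turnCap q φ w c i)
      (oriented_turnCap c i)

theorem ReidemeisterMove.preservesSignature {L R : List Slice} (h : ReidemeisterMove L R) :
    PreservesSignature L R := by
  rcases h with ⟨c, i, hc⟩ | ⟨c, i, hc⟩ | ⟨c, i, hc⟩ | ⟨c₁₂, c₁₃, c₂₃, i, h₁₂, h₁₃, h₂₃, h⟩
  · exact ⟨_, fun E _ _ _ q φ w => wordSig_r1Cup q φ w c i, oriented_r1Cup c i⟩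
  · exact ⟨_, fun E _ _ _ q φ w => wordSig_r1Cap q φ w c i, oriented_r1Cap c i⟩
  · exact preservesSignature_of_eq (fun E _ _ _ q φ w => wordSig_r2 q φ w c i hc)
      (oriented_r2 c i)
  -- The star is the side after the move for even `i` and the side before it for odd `i`.
  · refine ⟨-if i % 2 = 0 then starWeight c₁₂ c₁₃ c₂₃ else -starWeight c₁₂ c₁₃ c₂₃, ?_, ?_⟩
    · intro E _ _ _ q φ w
      obtain ⟨k, rfl | rfl⟩ := i.even_or_odd'
      · rw [wordSig_r3_even q φ w c₁₂ c₁₃ c₂₃ k h₁₂ h₁₃ h₂₃ h, if_pos (by omega)]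
        ring
      · rw [wordSig_r3_odd q φ w c₁₂ c₁₃ c₂₃ k h₁₂ h₁₃ h₂₃ h, if_neg (by omega)]
        ring
    · intro a a' μ
      rw [oriented_r3, ← sub_eq_add_neg]

/-- `σ` is the signature of the closed diagram `w` with respect to some orientation. -/
def HasSignature (w : List Slice) (σ : ℤ) : Prop :=
  ∃ a' μ, Oriented w (fun _ => true) a' μ ∧ σ = wordSig w Unit 0 0 - μ

/-- The slices of `u` only change the space, form and values from which the rest starts; hence the
hypothesis ranges over all of these. -/
theorem wordSig_append_left (u : List Slice) {v v' : List Slice} {s : ℤ}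
    (h : ∀ (E : Type) [AddCommGroup E] [Module ℝ E] [FiniteDimensional ℝ E]
      (q : QuadraticForm ℝ E) (φ : E →ₗ[ℝ] (ℕ → ℝ)), wordSig v E q φ = wordSig v' E q φ + s)
    (E : Type) [AddCommGroup E] [Module ℝ E] [FiniteDimensional ℝ E]
    (q : QuadraticForm ℝ E) (φ : E →ₗ[ℝ] (ℕ → ℝ)) :
    wordSig (u ++ v) E q φ = wordSig (u ++ v') E q φ + s := by
  induction u generalizing E with
  | nil => exact h E q φ
  | cons p u ih => exact ih _ _ _

theorem PreservesSignature.hasSignature_iff {L R : List Slice} (h : PreservesSignature L R)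
    (u v : List Slice) (σ : ℤ) : HasSignature (u ++ L ++ v) σ ↔ HasSignature (u ++ R ++ v) σ := by
  obtain ⟨s, h1, h2⟩ := h
  have h3 := wordSig_append_left u (fun E _ _ _ q φ => h1 E q φ v) Unit 0 0
  have h4 : ∀ a a' μ, Oriented (u ++ L ++ v) a a' (μ + s) ↔ Oriented (u ++ R ++ v) a a' μ := by
    intro a a' μ
    simp only [List.append_assoc, oriented_append]
    refine exists_congr fun b => exists_congr fun ν => and_congr_right fun _ =>
      exists_congr fun b' => ?_
    constructor
    · rintro ⟨κ, h5, h6⟩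
      refine ⟨κ - s, (h2 _ _ _).1 (by simpa using h5), ?_⟩
      convert h6 using 1
      ring
    · rintro ⟨κ, h5, h6⟩
      refine ⟨κ + s, (h2 _ _ _).2 h5, ?_⟩
      convert h6 using 1
      ring
  unfold HasSignature
  refine exists_congr fun a' => ?_
  rw [List.append_assoc, List.append_assoc, h3]
  constructor
  · rintro ⟨μ, h5, h6⟩
    refine ⟨μ - s, ?_, by rw [h6]; ring⟩
    rw [← List.append_assoc, ← h4, List.append_assoc]
    simpa using h5
  · rintro ⟨μ, h5, h6⟩
    refine ⟨μ + s, ?_, by rw [h6]; ring⟩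
    rw [← List.append_assoc, h4, List.append_assoc]
    exact h5

theorem ClassicalStep.hasSignature_iff {D E : ClassicalDiagram} (h : ClassicalStep D E) (σ : ℤ) :
    HasSignature D.1.word σ ↔ HasSignature E.1.word σ := by
  rcases h with ⟨u, v, L, R, h, hD, hE⟩ | ⟨u, v, L, R, h, hD, hE⟩
  · rw [hD, hE]
    exact h.preservesSignature.hasSignature_iff u v σ
  · rw [hD, hE]
    exact h.preservesSignature.hasSignature_iff u v σ

theorem hasSignature_iff_of_link_eq {D E : ClassicalDiagram} (h : D.link = E.link) (σ : ℤ) :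
    HasSignature D.1.word σ ↔ HasSignature E.1.word σ := by
  have h' := Quot.eqvGen_exact h
  clear h
  induction h' with
  | rel _ _ h => exact h.hasSignature_iff σ
  | refl => exact Iff.rfl
  | symm _ _ _ ih => exact ih.symm
  | trans _ _ _ _ _ ih ih' => exact ih.trans ih'

end Invariance

/-! ### The effect of crossing changes on the signature. -/

section CrossingChanges

/-- Later slices add the same terms to both forms, so their difference keeps its sign and still
vanishes where `l` does. -/
theorem wordSig_le_of_le {E : Type} [AddCommGroup E] [Module ℝ E] [FiniteDimensional ℝ E]
    {q q' : QuadraticForm ℝ E} (φ : E →ₗ[ℝ] (ℕ → ℝ)) (w : List Slice) (l : E →ₗ[ℝ] ℝ)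
    (h : ∀ e, q e ≤ q' e) (hl : ∀ e, l e = 0 → q' e = q e) :
    wordSig w E q φ ≤ wordSig w E q' φ ∧ wordSig w E q' φ ≤ wordSig w E q φ + 2 := by
  induction w generalizing E with
  | nil => exact sig_le_of_le_add_sq l h hl
  | cons p w ih =>
    refine ih _ (l ∘ₗ LinearMap.fst ℝ E ℝ) (fun e => ?_) (fun e he => ?_)
    · simpa using h e.1
    · simpa using hl e.1 he

/-- The signature of the form and the correction term move in the same direction, each by an amount
between 0 and 2, so their difference changes by at most 2. -/
theorem wordSig_slash_backslash {E : Type} [AddCommGroup E] [Module ℝ E] [FiniteDimensional ℝ E]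
    (q : QuadraticForm ℝ E) (φ : E →ₗ[ℝ] (ℕ → ℝ)) (w : List Slice) (i : ℕ) (s : Bool) :
    |(wordSig (.crossing .slash i :: w) E q φ - correction .slash i s) -
      (wordSig (.crossing .backslash i :: w) E q φ - correction .backslash i s)| ≤ 2 := by
  obtain ⟨k, rfl | rfl⟩ := i.even_or_odd'
  · have h := wordSig_le_of_le (q := nextForm (.crossing .backslash (2 * k)) q φ)
      (q' := nextForm (.crossing .slash (2 * k)) q φ) (nextValues (.crossing .slash (2 * k)) φ) w
      ((coordinate φ k - coordinate φ (k + 1)) ∘ₗ LinearMap.fst ℝ E ℝ) ?_ ?_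
    · have h1 : correction .slash (2 * k) s - correction .backslash (2 * k) s = 0 ∨
          correction .slash (2 * k) s - correction .backslash (2 * k) s = 2 := by
        cases s <;> simp [correction, Crossing.weight]
      rw [wordSig, wordSig, abs_le]
      have h2 : nextValues (.crossing .backslash (2 * k)) φ =
        nextValues (.crossing .slash (2 * k)) φ := rfl
      rw [h2]
      omega
    · rintro ⟨e, t⟩
      simp [energyFun_crossing_even, Crossing.weight]
      nlinarith [sq_nonneg (φ e k - φ e (k + 1))]
    · rintro ⟨e, t⟩ he
      simp at he
      simp [energyFun_crossing_even, he]
  · have h := wordSig_le_of_le (q := nextForm (.crossing .slash (2 * k + 1)) q φ)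
      (q' := nextForm (.crossing .backslash (2 * k + 1)) q φ)
      (nextValues (.crossing .slash (2 * k + 1)) φ) w
      (coordinate φ (k + 1) ∘ₗ LinearMap.fst ℝ E ℝ - LinearMap.snd ℝ E ℝ) ?_ ?_
    · have h1 : correction .slash (2 * k + 1) s - correction .backslash (2 * k + 1) s = 0 ∨
          correction .slash (2 * k + 1) s - correction .backslash (2 * k + 1) s = -2 := by
        cases s <;> simp [correction, Crossing.weight]
      rw [wordSig, wordSig, abs_le]
      have h2 : nextValues (.crossing .backslash (2 * k + 1)) φ =
        nextValues (.crossing .slash (2 * k + 1)) φ := rfl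
      rw [h2]
      omega
    · rintro ⟨e, t⟩
      simp [energyFun_crossing_odd, Crossing.weight]
      nlinarith [sq_nonneg (φ e (k + 1) - t)]
    · rintro ⟨e, t⟩ he
      simp at he
      simp [energyFun_crossing_odd, he]

theorem wordSig_switch {E : Type} [AddCommGroup E] [Module ℝ E] [FiniteDimensional ℝ E]
    (q : QuadraticForm ℝ E) (φ : E →ₗ[ℝ] (ℕ → ℝ)) (w : List Slice) (c : Crossing) (i : ℕ)
    (s : Bool) :
    |(wordSig (.crossing c i :: w) E q φ - correction c i s) -
      (wordSig (.crossing c.switch i :: w) E q φ - correction c.switch i s)| ≤ 2 := by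
  cases c
  · exact wordSig_slash_backslash q φ w i s
  · rw [abs_sub_comm]
    exact wordSig_slash_backslash q φ w i s
  · simp [Crossing.switch]

theorem wordSig_append_switch (u w : List Slice) (c : Crossing) (i : ℕ) (s : Bool)
    (E : Type) [AddCommGroup E] [Module ℝ E] [FiniteDimensional ℝ E]
    (q : QuadraticForm ℝ E) (φ : E →ₗ[ℝ] (ℕ → ℝ)) :
    |(wordSig (u ++ .crossing c i :: w) E q φ - correction c i s) -
      (wordSig (u ++ .crossing c.switch i :: w) E q φ - correction c.switch i s)| ≤ 2 := by
  induction u generalizing E with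
  | nil => exact wordSig_switch q φ w c i s
  | cons p u ih => exact ih _ _ _

theorem HasSignature.switch {u w : List Slice} {p : Slice} {σ : ℤ}
    (h : HasSignature (u ++ p :: w) σ) :
    ∃ σ', HasSignature (u ++ p.mapCrossing Crossing.switch :: w) σ' ∧ |σ - σ'| ≤ 2 := by
  rcases p with i | i | ⟨c, i⟩
  · exact ⟨σ, h, by simp⟩
  · exact ⟨σ, h, by simp⟩
  · obtain ⟨a', μ, h1, rfl⟩ := h
    rw [oriented_append] at h1
    obtain ⟨b, ν, h1, h2⟩ := h1
    simp only [Oriented] at h2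
    have h3 := wordSig_append_switch u w c i (b i == b (i + 1)) Unit 0 0
    -- The same orientation serves after the change, as directions do not depend on the crossing
    -- type; only one term of the correction differs.
    refine ⟨_, ⟨a', μ + (correction c.switch i (b i == b (i + 1)) -
      correction c i (b i == b (i + 1))), ?_, rfl⟩, ?_⟩
    · rw [oriented_append]
      refine ⟨b, ν, h1, ?_⟩
      simp only [Slice.mapCrossing, Oriented]
      convert h2 using 1
      ring
    · simp only [Slice.mapCrossing]
      rw [abs_le] at h3 ⊢
      omega

theorem modifyWord_insert (f : Crossing → Crossing) {k : ℕ} {S : Finset ℕ} (hk : k ∉ S)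
    (w : List Slice) : modifyWord f (insert k S) w = modifyWord f {k} (modifyWord f S w) := by
  unfold modifyWord
  rw [List.mapIdx_mapIdx]
  congr 1
  funext j p
  by_cases h : j = k
  · subst h
    simp [hk]
  · simp [h]

theorem modifyWord_singleton (f : Crossing → Crossing) (k : ℕ) (w : List Slice) :
    modifyWord f {k} w = w ∨ ∃ u p v, w = u ++ p :: v ∧
      modifyWord f {k} w = u ++ p.mapCrossing f :: v := by
  by_cases hk : k < w.length
  · right
    refine ⟨w.take k, w[k], w.drop (k + 1), by simp, ?_⟩
    apply List.ext_getElem?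
    intro j
    simp only [modifyWord, List.getElem?_mapIdx, Finset.mem_singleton]
    rcases lt_trichotomy j k with h | rfl | h
    · rw [List.getElem?_append_left (by simp; omega)]
      simp [h, h.ne]
    · rw [List.getElem?_append_right (by simp)]
      simp [hk, hk.le]
    · rw [List.getElem?_append_right (by simp; omega)]
      have h1 : min k w.length = k := by omega
      obtain ⟨d, rfl⟩ := Nat.exists_eq_add_of_lt h
      simp [h1, show k + d + 1 - k = d + 1 by omega, show k + d + 1 ≠ k by omega,
        show k + 1 + d = k + d + 1 by omega]
  · left
    apply List.ext_getElem?
    intro j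
    simp only [modifyWord, List.getElem?_mapIdx, Finset.mem_singleton]
    by_cases h : j = k
    · subst h
      simp [not_lt.1 hk]
    · simp [h]

theorem HasSignature.modifyWord_switch {w : List Slice} {σ : ℤ} (h : HasSignature w σ)
    (S : Finset ℕ) :
    ∃ σ', HasSignature (modifyWord Crossing.switch S w) σ' ∧ |σ - σ'| ≤ 2 * S.card := by
  induction S using Finset.induction_on with
  | empty =>
    have : modifyWord Crossing.switch ∅ w = w := List.ext_getElem? fun j => by simp [modifyWord]
    exact ⟨σ, by rwa [this], by simp⟩
  | insert k S hk ih =>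
    obtain ⟨σ', h1, h2⟩ := ih
    rw [modifyWord_insert _ hk, Finset.card_insert_of_notMem hk]
    rcases modifyWord_singleton Crossing.switch k (modifyWord Crossing.switch S w) with
      h3 | ⟨u, p, v, h3, h4⟩
    · rw [h3]
      refine ⟨σ', h1, ?_⟩
      push_cast
      linarith
    · rw [h3] at h1
      rw [h4]
      obtain ⟨σ'', h5, h6⟩ := h1.switch
      refine ⟨σ'', h5, ?_⟩
      have := abs_sub_le σ σ' σ''
      push_cast
      linarith

end CrossingChanges

/-! ### The signature of the torus knot and the lower bound. -/

section TorusKnots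

theorem sig_zero {E : Type} [AddCommGroup E] [Module ℝ E] :
    sig (0 : QuadraticForm ℝ E) = 0 := by
  unfold sig
  rw [← sigPos_neg, neg_zero, sub_self]

/-- This covers every orientation of the circle, so no signature of a knot has to be singled out:
one value is transported from the torus diagram. -/
theorem hasSignature_circle {σ : ℤ} (h : HasSignature Diagram.circle.word σ) : σ = 0 := by
  obtain ⟨a', μ, h1, rfl⟩ := h
  simp only [Diagram.circle, Oriented] at h1
  obtain ⟨_, -, -, rfl⟩ := h1
  simp only [Diagram.circle, wordSig, sub_zero]
  convert sig_zero
  ext z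
  simp [energyFun, regionFun]

theorem wordSig_replicate {E : Type} [AddCommGroup E] [Module ℝ E] [FiniteDimensional ℝ E]
    (q : QuadraticForm ℝ E) (φ : E →ₗ[ℝ] (ℕ → ℝ)) (w : List Slice) (m : ℕ) :
    wordSig (List.replicate m (.crossing .slash 0) ++ w) E q φ = wordSig w E
      (q + linMulLin ((m : ℝ) • (coordinate φ 0 - coordinate φ 1))
        (coordinate φ 0 - coordinate φ 1)) φ := by
  induction m generalizing q with
  | zero => exact wordSig_congr _ (fun e => by simp) fun e => rfl
  | succ m ih =>
    have h := wordSig_crossing_even q φ (List.replicate m (.crossing .slash 0) ++ w) .slash 0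
    rw [List.replicate_succ, List.cons_append]
    refine h.trans ?_
    rw [ih]
    refine wordSig_congr _ (fun e => ?_) fun e => rfl
    simp [Crossing.weight]
    ring

theorem oriented_replicate (w : List Slice) (m : ℕ) {a a' : ℕ → Bool} (h : a 0 = a 1) (μ : ℤ) :
    Oriented (List.replicate m (.crossing .slash 0) ++ w) a a' μ ↔ Oriented w a a' (μ - m) := by
  induction m generalizing μ with
  | zero => simp
  | succ m ih =>
    have h1 : swapPair a 0 = a := by
      funext j
      grind [swapPair]
    rw [List.replicate_succ, List.cons_append, Oriented, h1, ih]
    simp only [zero_add, h, beq_self_eq_true, correction, Nat.zero_mod, if_true, Crossing.weight]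
    push_cast
    rw [sub_sub, add_comm]

theorem hasSignature_torusDiagram (n : ℕ) : HasSignature (torusDiagram n).word (-(2 * n)) := by
  have hw : (torusDiagram n).word = .cup 0 :: .cup 1 ::
      (List.replicate (2 * n + 1) (.crossing .slash 0) ++ [.cap 1, .cap 0]) := by
    simp [torusDiagram, closedTwoBraidWord]
  rw [hw]
  have h1 : ∃ a', Oriented (.cup 0 :: .cup 1 ::
      (List.replicate (2 * n + 1) (.crossing .slash 0) ++ [.cap 1, .cap 0]))
      (fun _ => true) a' (2 * n + 1) := by
    -- Both braid strands go upwards, so each of the `2n+1` crossings contributes 1 to the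
    -- correction.
    refine ⟨removePair (removePair (insertPair (insertPair (fun _ => true) 0 true) 1 true) 1) 0,
      true, true, ?_⟩
    rw [oriented_replicate _ _ (by simp [insertPair])]
    refine ⟨by simp [insertPair], by simp [insertPair, removePair], rfl, by push_cast; ring⟩
  obtain ⟨a', h1⟩ := h1
  refine ⟨a', _, h1, ?_⟩
  suffices h : wordSig (.cup 0 :: .cup 1 ::
      (List.replicate (2 * n + 1) (.crossing .slash 0) ++ [.cap 1, .cap 0])) Unit 0 0 = 1 by
    rw [h]
    ring
  have hcup := fun w => wordSig_cup_even (0 : QuadraticForm ℝ Unit) 0 w 0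
  rw [mul_zero] at hcup
  rw [hcup, wordSig, wordSig_replicate]
  have hcap := fun (E : Type) [AddCommGroup E] [Module ℝ E] [FiniteDimensional ℝ E]
    (q : QuadraticForm ℝ E) φ w => wordSig_cap_odd q φ w 0
  rw [mul_zero, zero_add] at hcap
  rw [hcap, wordSig, wordSig]
  -- The only region with a free value is the one started by `cup 1`. The form is `2n+1` times its
  -- square; the last multiplier has zero coefficient because both outer values are 0.
  rw [Reduction.sig_eq (p := (0 : QuadraticForm ℝ (Unit × ℝ))) (k := ((0, 1), 0))
    (j := ((LinearMap.fst ℝ Unit ℝ).prod 0).prod (LinearMap.snd ℝ Unit ℝ))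
    (pr := (LinearMap.fst ℝ Unit ℝ ∘ₗ LinearMap.fst ℝ (Unit × ℝ) ℝ).prod
        (LinearMap.snd ℝ (Unit × ℝ) ℝ))]
  · simp [sig_zero, energyFun, regionFun]
    rw [sign_pos (by positivity)]
    rfl
  · constructor
    · rintro ⟨u, s⟩
      simp [polar, energyFun, regionFun]
    · rintro ⟨u, s⟩
      simp [energyFun, regionFun]
    · rintro ⟨⟨u, t⟩, s⟩ -
      exact ⟨t, by ext <;> simp⟩

theorem le_unknottingNumber_torusKnot (n : ℕ) : (n : ℕ∞) ≤ (torusKnot n).unknottingNumber := by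
  refine le_iInf₂ fun D hD => le_iInf fun S => le_iInf₂ fun _ hS => ?_
  have h1 := (hasSignature_iff_of_link_eq hD _).2 (hasSignature_torusDiagram n)
  obtain ⟨σ, h2, h3⟩ := h1.modifyWord_switch S
  obtain rfl := hasSignature_circle ((hasSignature_iff_of_link_eq hS σ).1 h2)
  rw [sub_zero, abs_neg, abs_of_nonneg (by positivity)] at h3
  exact_mod_cast (by omega : n ≤ S.card)

end TorusKnots

/-! ### Replacement of tangles in welded diagrams. -/

section WeldedMoves

theorem isTangle_append (u v : List Slice) (m n : ℕ) :
    IsTangle m (u ++ v) n ↔ ∃ k, IsTangle m u k ∧ IsTangle k v n := by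
  induction u generalizing m with
  | nil => simp [IsTangle]
  | cons p u ih => simp [IsTangle, ih, and_assoc]

/-- The moves of welded diagrams. -/
def IsWeldedMove (L R : List Slice) : Prop :=
  PlaneIsotopy L R ∨ ReidemeisterMove L R ∨ VirtualMove L R ∨ OverForbiddenMove L R

/-- Two tangle diagrams with `m` strands at the bottom and `n` strands at the top can be replaced
by each other in welded diagrams. -/
structure WeldedEq (m n : ℕ) (L R : List Slice) : Prop where
  left : IsTangle m L n
  right : IsTangle m R n
  link_eq : ∀ u v (h₁ : IsTangle 0 (u ++ (L ++ v)) 0) (h₂ : IsTangle 0 (u ++ (R ++ v)) 0),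
    IsTangle 0 u m → IsTangle n v 0 →
    Diagram.weldedLink ⟨u ++ (L ++ v), h₁⟩ = Diagram.weldedLink ⟨u ++ (R ++ v), h₂⟩

theorem IsWeldedMove.weldedEq {L R : List Slice} (h : IsWeldedMove L R) {m n : ℕ}
    (hL : IsTangle m L n) (hR : IsTangle m R n) : WeldedEq m n L R := by
  refine ⟨hL, hR, fun u v h₁ h₂ _ _ => Quot.sound ?_⟩
  rcases h with h | h | h | h
  · exact Or.inl ⟨u, v, L, R, h, by simp, by simp⟩
  · exact Or.inr (Or.inl ⟨u, v, L, R, h, by simp, by simp⟩)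
  · exact Or.inr (Or.inr (Or.inl ⟨u, v, L, R, h, by simp, by simp⟩))
  · exact Or.inr (Or.inr (Or.inr ⟨u, v, L, R, h, by simp, by simp⟩))

namespace WeldedEq

variable {m n m' n' : ℕ} {L R T : List Slice}

theorem refl (h : IsTangle m L n) : WeldedEq m n L L := ⟨h, h, fun _ _ _ _ _ _ => rfl⟩

theorem symm (h : WeldedEq m n L R) : WeldedEq m n R L :=
  ⟨h.right, h.left, fun u v h₁ h₂ hu hv => (h.link_eq u v h₂ h₁ hu hv).symm⟩

theorem trans (h : WeldedEq m n L R) (h' : WeldedEq m n R T) : WeldedEq m n L T := by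
  refine ⟨h.left, h'.right, fun u v h₁ h₂ hu hv => ?_⟩
  -- The intermediate word must again be a closed diagram; this is why the relation records the
  -- numbers of strands.
  have h₃ : IsTangle 0 (u ++ (R ++ v)) 0 :=
    (isTangle_append _ _ _ _).2 ⟨m, hu, (isTangle_append _ _ _ _).2 ⟨n, h.right, hv⟩⟩
  exact (h.link_eq u v h₁ h₃ hu hv).trans (h'.link_eq u v h₃ h₂ hu hv)

instance : Trans (WeldedEq m n) (WeldedEq m n) (WeldedEq m n) := ⟨trans⟩

theorem context (h : WeldedEq m n L R) (u v : List Slice) (hu : IsTangle m' u m)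
    (hv : IsTangle n v n') : WeldedEq m' n' (u ++ (L ++ v)) (u ++ (R ++ v)) := by
  have key : ∀ {L}, IsTangle m L n → IsTangle m' (u ++ (L ++ v)) n' := fun hL =>
    (isTangle_append _ _ _ _).2 ⟨m, hu, (isTangle_append _ _ _ _).2 ⟨n, hL, hv⟩⟩
  refine ⟨key h.left, key h.right, fun u' v' h₁ h₂ hu' hv' => ?_⟩
  have := h.link_eq (u' ++ u) (v ++ v') (by simpa using h₁) (by simpa using h₂)
    ((isTangle_append _ _ _ _).2 ⟨m', hu', hu⟩) ((isTangle_append _ _ _ _).2 ⟨n', hv, hv'⟩)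
  simpa using this

theorem append_left (h : WeldedEq m n L R) (u : List Slice) (hu : IsTangle m' u m) :
    WeldedEq m' n (u ++ L) (u ++ R) := by
  simpa using h.context u [] hu rfl

theorem append_right (h : WeldedEq m n L R) (v : List Slice) (hv : IsTangle n v n') :
    WeldedEq m n' (L ++ v) (R ++ v) := by
  simpa using h.context [] v rfl hv

end WeldedEq

theorem shift_shift (p : Slice) (a b : ℕ) : (p.shift a).shift b = p.shift (b + a) := by
  cases p <;> simp [Slice.shift, add_assoc]

/-- A slice to the right of a tangle diagram can be moved past it. -/
theorem WeldedEq.slide (X : List Slice) {a b d m n : ℕ} (p : Slice) (hX : IsTangle a X b)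
    (hm : m = a + d) (hp : p.pos + p.ins ≤ d) (hn : n = b + (d - p.ins + p.outs)) :
    WeldedEq m n (X ++ [p.shift b]) (p.shift a :: X) := by
  have hpos : ∀ k, (p.shift k).pos = k + p.pos := by intro k; cases p <;> rfl
  have hins : ∀ k, (p.shift k).ins = p.ins := by intro k; cases p <;> rfl
  have houts : ∀ k, (p.shift k).outs = p.outs := by intro k; cases p <;> rfl
  induction X generalizing a m with
  | nil =>
    obtain rfl : a = b := hX
    refine refl ⟨?_, ?_⟩
    · rw [hpos, hins]; omega
    · rw [hins, houts]; simp only [IsTangle]; omega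
  | cons r X ih =>
    obtain ⟨hr, hX⟩ := hX
    have h1 := ih (m := m - r.ins + r.outs) hX (by omega)
    have h2 := h1.append_left (m' := m) [r] ⟨by omega, rfl⟩
    refine h2.trans ?_
    obtain ⟨e, rfl⟩ := Nat.exists_eq_add_of_le hr
    have h3 : PlaneIsotopy [r, (p.shift e).shift (r.pos + r.outs)]
        [(p.shift e).shift (r.pos + r.ins), r] := .exchange _ _
    rw [shift_shift, shift_shift] at h3
    rw [show r.pos + r.ins + e - r.ins + r.outs = r.pos + r.outs + e by omega] at hX ⊢
    have h4 : WeldedEq m (m - r.ins + r.outs - p.ins + p.outs)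
        [r, p.shift (r.pos + r.outs + e)] [p.shift (r.pos + r.ins + e), r] := by
      refine IsWeldedMove.weldedEq (Or.inl h3) ⟨by omega, ?_, ?_⟩ ⟨?_, ?_, ?_⟩
      · rw [hpos, hins]; omega
      · rw [hins, houts]; rfl
      · rw [hpos, hins]; omega
      · rw [hins, houts]; omega
      · rw [hins, houts]; simp only [IsTangle]; omega
    refine h4.append_right X ?_
    have h5 := h1.right.2
    rw [hins, houts] at h5
    exact h5

theorem WeldedEq.of_isotopy {L R : List Slice} (h : PlaneIsotopy L R) {m n : ℕ}
    (hL : IsTangle m L n) (hR : IsTangle m R n) : WeldedEq m n L R :=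
  IsWeldedMove.weldedEq (Or.inl h) hL hR

theorem WeldedEq.of_reidemeister {L R : List Slice} (h : ReidemeisterMove L R) {m n : ℕ}
    (hL : IsTangle m L n) (hR : IsTangle m R n) : WeldedEq m n L R :=
  IsWeldedMove.weldedEq (Or.inr (Or.inl h)) hL hR

theorem WeldedEq.of_virtual {L R : List Slice} (h : VirtualMove L R) {m n : ℕ}
    (hL : IsTangle m L n) (hR : IsTangle m R n) : WeldedEq m n L R :=
  IsWeldedMove.weldedEq (Or.inr (Or.inr (Or.inl h))) hL hR

theorem WeldedEq.of_overForbidden {L R : List Slice} (h : OverForbiddenMove L R) {m n : ℕ}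
    (hL : IsTangle m L n) (hR : IsTangle m R n) : WeldedEq m n L R :=
  IsWeldedMove.weldedEq (Or.inr (Or.inr (Or.inr h))) hL hR

end WeldedMoves

/-! ### Unknotting the closed braid of classical and virtual crossings. -/

section Twists

instance decidableIsTangle : (m : ℕ) → (w : List Slice) → (n : ℕ) → Decidable (IsTangle m w n)
  | m, [], n => inferInstanceAs (Decidable (m = n))
  | m, p :: w, n =>
    have := decidableIsTangle (m - p.ins + p.outs) w n
    inferInstanceAs (Decidable (_ ∧ _))

/-- The virtual crossing of the strands at the places `i` and `i + 1`. -/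
abbrev virtAt (i : ℕ) : Slice := .crossing .virt i

/-- The classical crossing at the places `i` and `i + 1` with the slash strand over. -/
abbrev slashAt (i : ℕ) : Slice := .crossing .slash i

theorem isTangle_add {a b : ℕ} {X : List Slice} (d : ℕ) (h : IsTangle a X b) :
    IsTangle (a + d) X (b + d) := by
  induction X generalizing a with
  | nil => exact congrArg (· + d) h
  | cons p X ih =>
    obtain ⟨h1, h2⟩ := h
    refine ⟨by omega, ?_⟩
    rw [show a + d - p.ins + p.outs = a - p.ins + p.outs + d by omega]
    exact ih h2

namespace WeldedEq

/-- The crossing turns through one maximum, the maxima, now side by side, exchange heights, and it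
turns through the other. A virtual crossing is not altered by the turns. -/
theorem slide_cap_cap (i l : ℕ) : WeldedEq (i + l + 4) (i + l)
    [virtAt i, .cap (i + 1), .cap i] [virtAt (i + 2), .cap (i + 1), .cap i] := by
  have h1 : WeldedEq (i + l + 4) (i + l + 2) [virtAt (i + 1), .cap i] [virtAt i, .cap (i + 1)] :=
    of_isotopy (.turnCap .virt i) (by simp [IsTangle, Slice.pos, Slice.ins, Slice.outs]; omega)
      (by simp [IsTangle, Slice.pos, Slice.ins, Slice.outs]; omega)
  have h2 : WeldedEq (i + l + 4) (i + l + 2) [virtAt (i + 2), .cap (i + 1)]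
      [virtAt (i + 1), .cap (i + 2)] :=
    of_isotopy (.turnCap .virt (i + 1))
      (by simp [IsTangle, Slice.pos, Slice.ins, Slice.outs]; omega)
      (by simp [IsTangle, Slice.pos, Slice.ins, Slice.outs]; omega)
  have h3 : WeldedEq (i + l + 4) (i + l) [.cap i, .cap i] [.cap (i + 2), .cap i] :=
    of_isotopy (.exchange (.cap i) (.cap 0))
      (by simp [IsTangle, Slice.shift, Slice.pos, Slice.ins, Slice.outs]; omega)
      (by simp [IsTangle, Slice.shift, Slice.pos, Slice.ins, Slice.outs])
  have hc : ∀ j, j ≤ i → IsTangle (i + l + 2) [.cap j] (i + l) := by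
    intro j hj
    simp [IsTangle, Slice.pos, Slice.ins, Slice.outs]
    omega
  have hv : IsTangle (i + l + 4) [virtAt (i + 1)] (i + l + 4) := by
    simp [IsTangle, Slice.pos, Slice.ins, Slice.outs]
    omega
  calc WeldedEq (i + l + 4) (i + l) [virtAt i, .cap (i + 1), .cap i]
        [virtAt (i + 1), .cap i, .cap i] := h1.symm.append_right [.cap i] (hc i le_rfl)
    WeldedEq _ _ _ [virtAt (i + 1), .cap (i + 2), .cap i] := h3.append_left [virtAt (i + 1)] hv
    WeldedEq _ _ _ [virtAt (i + 2), .cap (i + 1), .cap i] :=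
        h2.symm.append_right [.cap i] (hc i le_rfl)

theorem slide_cup_cup (i l : ℕ) : WeldedEq (i + l) (i + l + 4)
    [.cup i, .cup (i + 1), virtAt i] [.cup i, .cup (i + 1), virtAt (i + 2)] := by
  have h1 : WeldedEq (i + l + 2) (i + l + 4) [.cup i, virtAt (i + 1)] [.cup (i + 1), virtAt i] :=
    of_isotopy (.turnCup .virt i) (by simp [IsTangle, Slice.pos, Slice.ins, Slice.outs]; omega)
      (by simp [IsTangle, Slice.pos, Slice.ins, Slice.outs]; omega)
  have h2 : WeldedEq (i + l + 2) (i + l + 4) [.cup (i + 1), virtAt (i + 2)]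
      [.cup (i + 2), virtAt (i + 1)] :=
    of_isotopy (.turnCup .virt (i + 1))
      (by simp [IsTangle, Slice.pos, Slice.ins, Slice.outs]; omega)
      (by simp [IsTangle, Slice.pos, Slice.ins, Slice.outs]; omega)
  have h3 : WeldedEq (i + l) (i + l + 4) [.cup i, .cup (i + 2)] [.cup i, .cup i] :=
    of_isotopy (.exchange (.cup i) (.cup 0))
      (by simp [IsTangle, Slice.shift, Slice.pos, Slice.ins, Slice.outs])
      (by simp [IsTangle, Slice.shift, Slice.pos, Slice.ins, Slice.outs]; omega)
  have hc : IsTangle (i + l) [.cup i] (i + l + 2) := by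
    simp [IsTangle, Slice.pos, Slice.ins, Slice.outs]
  have hv : IsTangle (i + l + 4) [virtAt (i + 1)] (i + l + 4) := by
    simp [IsTangle, Slice.pos, Slice.ins, Slice.outs]
    omega
  calc WeldedEq (i + l) (i + l + 4) [.cup i, .cup (i + 1), virtAt i]
        [.cup i, .cup i, virtAt (i + 1)] := h1.symm.append_left [.cup i] hc
    WeldedEq _ _ _ [.cup i, .cup (i + 2), virtAt (i + 1)] :=
        h3.symm.append_right [virtAt (i + 1)] hv
    WeldedEq _ _ _ [.cup i, .cup (i + 1), virtAt (i + 2)] := h2.symm.append_left [.cup i] hc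

/-- A virtual crossing can be moved around the closure of a braid. -/
theorem conjugate (i l : ℕ) (X : List Slice) (hX : IsTangle (i + 2) X (i + 2)) :
    WeldedEq (i + l) (i + l) ([.cup i, .cup (i + 1)] ++ (X ++ [virtAt i, .cap (i + 1), .cap i]))
      ([.cup i, .cup (i + 1), virtAt i] ++ (X ++ [.cap (i + 1), .cap i])) := by
  have hX' : IsTangle (i + l + 4) X (i + l + 4) := by
    have := isTangle_add (l + 2) hX
    rwa [show i + 2 + (l + 2) = i + l + 4 by ring] at this
  have hcup : IsTangle (i + l) [.cup i, .cup (i + 1)] (i + l + 4) := by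
    simp [IsTangle, Slice.pos, Slice.ins, Slice.outs]
    omega
  have hcap : IsTangle (i + l + 4) [.cap (i + 1), .cap i] (i + l) := by
    simp [IsTangle, Slice.pos, Slice.ins, Slice.outs]
    omega
  have h1 : WeldedEq (i + l + 4) (i + l + 4) (X ++ [virtAt (i + 2)]) (virtAt (i + 2) :: X) :=
    slide X (virtAt 0) hX (d := l + 2) (by ring) (by simp [Slice.pos, Slice.ins])
      (by simp [Slice.ins, Slice.outs]; ring)
  have s1 := ((slide_cap_cap i l).append_left X hX').append_left _ hcup
  have s2 := h1.context [.cup i, .cup (i + 1)] [.cap (i + 1), .cap i] hcup hcap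
  have s3 := (slide_cup_cup i l).symm.append_right (X ++ [.cap (i + 1), .cap i])
    ((isTangle_append _ _ _ _).2 ⟨_, hX', hcap⟩)
  simp only [List.append_assoc, List.cons_append, List.nil_append] at s1 s2 s3 ⊢
  exact (s1.trans s2).trans s3

/-- Read backwards, this is a virtual stabilisation: it supplies a third braid strand. -/
theorem virt_kink : WeldedEq 4 4 [.cup 2, virtAt 1, .cap 2] [] :=
  calc WeldedEq 4 4 [.cup 2, virtAt 1, .cap 2] [.cup 2, virtAt 2, .cap 1] :=
        (of_isotopy (.turnCap .virt 1) (m := 6) (n := 4) (by decide) (by decide)).symm.append_left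
          [.cup 2] (by decide)
    WeldedEq 4 4 _ [.cup 2, .cap 1] :=
        (of_virtual (.vr1Cup 2) (m := 4) (n := 6) (by decide) (by decide)).append_right
          [.cap 1] (by decide)
    WeldedEq 4 4 _ [] := of_isotopy (.zigzagRight 1) (by decide) (by decide)

/-- Turning the outer virtual crossings allows a detour past the classical one. They then become
virtual kinks, and a classical kink is left for the first Reidemeister move. -/
theorem slash_kink : WeldedEq 4 4 [.cup 2, virtAt 1, slashAt 1, virtAt 1, .cap 2] [] :=
  calc WeldedEq 4 4 [.cup 2, virtAt 1, slashAt 1, virtAt 1, .cap 2]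
        [.cup 1, virtAt 2, slashAt 1, virtAt 1, .cap 2] :=
        (of_isotopy (.turnCup .virt 1) (m := 4) (n := 6) (by decide) (by decide)).symm.append_right
          [slashAt 1, virtAt 1, .cap 2] (by decide)
    WeldedEq 4 4 _ [.cup 1, virtAt 2, slashAt 1, virtAt 2, .cap 1] :=
        (of_isotopy (.turnCap .virt 1) (m := 6) (n := 4) (by decide) (by decide)).symm.append_left
          [.cup 1, virtAt 2, slashAt 1] (by decide)
    WeldedEq 4 4 _ [.cup 1, virtAt 1, slashAt 2, virtAt 1, .cap 1] :=
        (of_virtual (.vr4Second .slash 1 (by simp [Crossing.IsClassical])) (m := 6) (n := 6) (by decide)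
          (by decide)).symm.context [.cup 1] [.cap 1] (by decide) (by decide)
    WeldedEq 4 4 _ [.cup 1, slashAt 2, virtAt 1, .cap 1] :=
        (of_virtual (.vr1Cup 1) (m := 4) (n := 6) (by decide) (by decide)).append_right
          [slashAt 2, virtAt 1, .cap 1] (by decide)
    WeldedEq 4 4 _ [.cup 1, slashAt 2, .cap 1] :=
        (of_virtual (.vr1Cap 1) (m := 6) (n := 4) (by decide) (by decide)).append_left
          [.cup 1, slashAt 2] (by decide)
    WeldedEq 4 4 _ [.cup 2, .crossing .backslash 1, .cap 1] :=
        (of_isotopy (.turnCup .slash 1) (m := 4) (n := 6) (by decide) (by decide)).append_right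
          [.cap 1] (by decide)
    WeldedEq 4 4 _ [.cup 2, .cap 1] :=
        (of_reidemeister (.r1Cap .backslash 1 (by simp [Crossing.IsClassical])) (m := 6) (n := 4) (by decide)
          (by decide)).append_left [.cup 2] (by decide)
    WeldedEq 4 4 _ [] := of_isotopy (.zigzagRight 1) (by decide) (by decide)

/-- Virtual detour past a classical crossing. -/
theorem virt_virt_slash : WeldedEq 6 6 [virtAt 0, virtAt 1, slashAt 0]
    [slashAt 1, virtAt 0, virtAt 1] :=
  of_virtual (.vr4First .slash 0 (by simp [Crossing.IsClassical])) (by decide) (by decide)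

theorem virt_braid : WeldedEq 6 6 [virtAt 0, virtAt 1, virtAt 0] [virtAt 1, virtAt 0, virtAt 1] :=
  of_virtual (.vr3 0) (by decide) (by decide)

theorem virt_zero_virt_zero : WeldedEq 6 6 [virtAt 0, virtAt 0] [] :=
  of_virtual (.vr2 0) (by decide) (by decide)

theorem virt_one_virt_one : WeldedEq 6 6 [virtAt 1, virtAt 1] [] :=
  of_virtual (.vr2 1) (by decide) (by decide)

theorem over_forbidden : WeldedEq 6 6 [slashAt 0, slashAt 1, virtAt 0]
    [virtAt 1, slashAt 0, slashAt 1] :=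
  of_overForbidden (.first 0) (by decide) (by decide)

/-- A strand passes over two others in both orders. -/
theorem over_commute : WeldedEq 6 6
    [slashAt 0, virtAt 0, virtAt 1, slashAt 0, virtAt 0, virtAt 1]
    [virtAt 1, slashAt 0, virtAt 0, virtAt 1, slashAt 0, virtAt 0] := by
  have h1 : WeldedEq 6 6 [slashAt 0, virtAt 0, virtAt 1, slashAt 0, virtAt 0, virtAt 1]
      [slashAt 0, slashAt 1, virtAt 1, virtAt 0] :=
    calc WeldedEq 6 6 [slashAt 0, virtAt 0, virtAt 1, slashAt 0, virtAt 0, virtAt 1]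
          [slashAt 0, slashAt 1, virtAt 0, virtAt 1, virtAt 0, virtAt 1] :=
          virt_virt_slash.context [slashAt 0] [virtAt 0, virtAt 1] (by decide) (by decide)
      WeldedEq 6 6 _ [slashAt 0, slashAt 1, virtAt 0, virtAt 0, virtAt 1, virtAt 0] :=
          virt_braid.symm.append_left [slashAt 0, slashAt 1, virtAt 0] (by decide)
      WeldedEq 6 6 _ [slashAt 0, slashAt 1, virtAt 1, virtAt 0] :=
          virt_zero_virt_zero.context [slashAt 0, slashAt 1] [virtAt 1, virtAt 0] (by decide)
            (by decide)
  have h2 : WeldedEq 6 6 [virtAt 1, slashAt 0, virtAt 0, virtAt 1, slashAt 0, virtAt 0]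
      [slashAt 0, slashAt 1, virtAt 1, virtAt 0] :=
    calc WeldedEq 6 6 [virtAt 1, slashAt 0, virtAt 0, virtAt 1, slashAt 0, virtAt 0]
          [virtAt 1, slashAt 0, slashAt 1, virtAt 0, virtAt 1, virtAt 0] :=
          virt_virt_slash.context [virtAt 1, slashAt 0] [virtAt 0] (by decide) (by decide)
      WeldedEq 6 6 _ [slashAt 0, slashAt 1, virtAt 0, virtAt 0, virtAt 1, virtAt 0] :=
          over_forbidden.symm.append_right [virtAt 0, virtAt 1, virtAt 0] (by decide)
      WeldedEq 6 6 _ [slashAt 0, slashAt 1, virtAt 1, virtAt 0] :=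
          virt_zero_virt_zero.context [slashAt 0, slashAt 1] [virtAt 1, virtAt 0] (by decide)
            (by decide)
  exact h1.trans h2.symm

end WeldedEq

/-- The braid of `p` pairs of a classical and a virtual crossing. -/
def twists : ℕ → List Slice
  | 0 => []
  | p + 1 => twists p ++ [slashAt 0, virtAt 0]

theorem isTangle_twists (p m : ℕ) (hm : 2 ≤ m) : IsTangle m (twists p) m := by
  induction p with
  | zero => rfl
  | succ p ih =>
    refine (isTangle_append _ _ _ _).2 ⟨m, ih, ?_⟩
    simp [IsTangle, Slice.pos, Slice.ins, Slice.outs]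
    omega

namespace WeldedEq

/-- In each pair of `twists` the first strand goes over the second and returns to its place; in the
other factor it goes over the third. Overpasses of the same strand commute by `over_commute`. -/
theorem twists_commute (p : ℕ) : WeldedEq 6 6 (twists p ++ [virtAt 1, slashAt 0, virtAt 0, virtAt 1])
    ([virtAt 1, slashAt 0, virtAt 0, virtAt 1] ++ twists p) := by
  induction p with
  | zero => exact refl (by decide)
  | succ p ih =>
    have h1 := over_commute.append_left (twists p) (isTangle_twists p 6 (by omega))
    have h2 := ih.append_right [slashAt 0, virtAt 0] (n' := 6) (by decide)
    simp only [twists, List.append_assoc, List.cons_append, List.nil_append] at h1 h2 ⊢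
    exact h1.trans h2

/-- The crossing after `twists p` is an overpass over the third strand followed by virtual
crossings, so it can be pulled below all the pairs. -/
theorem twists_virt_slash (p : ℕ) : WeldedEq 6 6 (twists p ++ [virtAt 1, slashAt 0])
    ([virtAt 1, slashAt 0, virtAt 0, virtAt 1] ++ (twists p ++ [virtAt 1, virtAt 0])) := by
  have hp := isTangle_twists p 6 (by omega)
  have h1 : WeldedEq 6 6 [virtAt 1, slashAt 0]
      [virtAt 1, slashAt 0, virtAt 0, virtAt 1, virtAt 1, virtAt 0] :=
    calc WeldedEq 6 6 [virtAt 1, slashAt 0] [virtAt 1, slashAt 0, virtAt 0, virtAt 0] :=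
          virt_zero_virt_zero.symm.append_left [virtAt 1, slashAt 0] (by decide)
      WeldedEq 6 6 _ [virtAt 1, slashAt 0, virtAt 0, virtAt 1, virtAt 1, virtAt 0] :=
          virt_one_virt_one.symm.context [virtAt 1, slashAt 0, virtAt 0] [virtAt 0] (by decide)
            (by decide)
  have h2 := h1.append_left (twists p) hp
  have h3 := (twists_commute p).append_right [virtAt 1, virtAt 0] (n' := 6) (by decide)
  simp only [List.append_assoc, List.cons_append, List.nil_append] at h2 h3 ⊢
  exact h2.trans h3

theorem unwind : WeldedEq 6 6 [virtAt 0, virtAt 1, slashAt 0, virtAt 0, virtAt 1]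
    [slashAt 1, virtAt 1, virtAt 0] :=
  calc WeldedEq 6 6 [virtAt 0, virtAt 1, slashAt 0, virtAt 0, virtAt 1]
        [slashAt 1, virtAt 0, virtAt 1, virtAt 0, virtAt 1] :=
        virt_virt_slash.append_right [virtAt 0, virtAt 1] (by decide)
    WeldedEq 6 6 _ [slashAt 1, virtAt 0, virtAt 0, virtAt 1, virtAt 0] :=
        virt_braid.symm.append_left [slashAt 1, virtAt 0] (by decide)
    WeldedEq 6 6 _ [slashAt 1, virtAt 1, virtAt 0] :=
        virt_zero_virt_zero.context [slashAt 1] [virtAt 1, virtAt 0] (by decide) (by decide)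

/-- One pair of crossings can be removed from the closure of the braid. -/
theorem twists_succ (p : ℕ) : WeldedEq 0 0
    ([.cup 0, .cup 1] ++ (twists (p + 1) ++ [slashAt 0, .cap 1, .cap 0]))
    ([.cup 0, .cup 1] ++ (twists p ++ [slashAt 0, .cap 1, .cap 0])) := by
  set T := twists (p + 1) with hT
  have t2 : IsTangle 2 T 2 := isTangle_twists _ _ (by omega)
  have t4 : IsTangle 4 T 4 := isTangle_twists _ _ (by omega)
  have t6 : IsTangle 6 T 6 := isTangle_twists _ _ (by omega)
  -- Stabilise between `T` and the last classical crossing, and stretch the new strand along the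
  -- braid. The last crossing is then with the third strand and can be pulled below `T`.
  have s1 := virt_kink.symm.context ([.cup 0, .cup 1] ++ T) [slashAt 0, .cap 1, .cap 0]
    (m' := 0) (n' := 0) ((isTangle_append _ _ _ _).2 ⟨4, by decide, t4⟩) (by decide)
  have s2 : WeldedEq 4 6 (T ++ [.cup 2]) (.cup 2 :: T) :=
    slide T (.cup 0) t2 (d := 2) rfl (by decide) rfl
  replace s2 := s2.context [.cup 0, .cup 1] [virtAt 1, .cap 2, slashAt 0, .cap 1, .cap 0]
    (m' := 0) (n' := 0) (by decide) (by decide)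
  have s3 : WeldedEq 6 4 [slashAt 0, .cap 2] [.cap 2, slashAt 0] :=
    of_isotopy (.exchange (slashAt 0) (.cap 0)) (by decide) (by decide)
  replace s3 := s3.symm.context ([.cup 0, .cup 1, .cup 2] ++ (T ++ [virtAt 1]))
    [.cap 1, .cap 0] (m' := 0) (n' := 0) ((isTangle_append _ _ _ _).2
      ⟨6, by decide, (isTangle_append _ _ _ _).2 ⟨6, t6, by decide⟩⟩) (by decide)
  have s4 := (twists_virt_slash (p + 1)).context [.cup 0, .cup 1, .cup 2] [.cap 2, .cap 1, .cap 0]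
    (m' := 0) (n' := 0) (by decide) (by decide)
  have s5 : WeldedEq 6 4 [virtAt 0, .cap 2] [.cap 2, virtAt 0] :=
    of_isotopy (.exchange (virtAt 0) (.cap 0)) (by decide) (by decide)
  replace s5 := s5.context ([.cup 0, .cup 1, .cup 2, virtAt 1, slashAt 0, virtAt 0, virtAt 1] ++
      (T ++ [virtAt 1])) [.cap 1, .cap 0] (m' := 0) (n' := 0) ((isTangle_append _ _ _ _).2
      ⟨6, by decide, (isTangle_append _ _ _ _).2 ⟨6, t6, by decide⟩⟩) (by decide)
  -- The trailing virtual crossing travels around the closure, so that `unwind` brings the classical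
  -- crossing to the second and third strands.
  have s6 := conjugate 0 0 ([.cup 2, virtAt 1, slashAt 0, virtAt 0, virtAt 1] ++
      (T ++ [virtAt 1, .cap 2])) ((isTangle_append _ _ _ _).2
      ⟨4, by decide, (isTangle_append _ _ _ _).2 ⟨4, t4, by decide⟩⟩)
  have s7 : WeldedEq 4 6 [virtAt 0, .cup 2] [.cup 2, virtAt 0] :=
    of_isotopy (.exchange (virtAt 0) (.cup 0)) (by decide) (by decide)
  replace s7 := s7.context [.cup 0, .cup 1] ([virtAt 1, slashAt 0, virtAt 0, virtAt 1] ++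
      (T ++ [virtAt 1, .cap 2, .cap 1, .cap 0])) (m' := 0) (n' := 0) (by decide)
      ((isTangle_append _ _ _ _).2
      ⟨6, by decide, (isTangle_append _ _ _ _).2 ⟨6, t6, by decide⟩⟩)
  have s8 := unwind.context [.cup 0, .cup 1, .cup 2] (T ++ [virtAt 1, .cap 2, .cap 1, .cap 0])
      (m' := 0) (n' := 0) (by decide) ((isTangle_append _ _ _ _).2 ⟨6, t6, by decide⟩)
  -- The remaining virtual crossing with the third strand goes around the inner two closing arcs. It
  -- completes the pattern of `slash_kink`, which removes the classical crossing together with the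
  -- third strand.
  have s9 := (conjugate 1 1 ([slashAt 1, virtAt 1, virtAt 0] ++ T) ((isTangle_append _ _ _ _).2
      ⟨3, by decide, isTangle_twists _ _ (by omega)⟩)).context [.cup 0] [.cap 0]
      (m' := 0) (n' := 0) (by decide) (by decide)
  have s10 : WeldedEq 6 4 (virtAt 0 :: T ++ [.cap 2]) (.cap 2 :: virtAt 0 :: T) :=
    slide (virtAt 0 :: T) (.cap 0) (a := 2) ⟨by decide, t2⟩ (d := 4) rfl (by decide) rfl
  replace s10 := s10.context [.cup 0, .cup 1, .cup 2, virtAt 1, slashAt 1, virtAt 1]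
    [.cap 1, .cap 0] (m' := 0) (n' := 0) (by decide) (by decide)
  have s11 := slash_kink.context [.cup 0, .cup 1] (virtAt 0 :: (T ++ [.cap 1, .cap 0]))
    (m' := 0) (n' := 0) (by decide)
    ⟨by decide, (isTangle_append _ _ _ _).2 ⟨4, t4, by decide⟩⟩
  -- What is left is the closure of a virtual crossing followed by `T`. Conjugation moves the
  -- crossing to the end, where it cancels the last virtual crossing of `T`.
  have s12 := (conjugate 0 0 T t2).symm
  have s13 := (of_virtual (.vr2 0) (m := 4) (n := 4) (by decide) (by decide)).context
    ([.cup 0, .cup 1] ++ (twists p ++ [slashAt 0])) [.cap 1, .cap 0] (m' := 0) (n' := 0)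
    ((isTangle_append _ _ _ _).2 ⟨4, by decide, (isTangle_append _ _ _ _).2
      ⟨4, isTangle_twists _ _ (by omega), by decide⟩⟩) (by decide)
  rw [← hT] at s4
  rw [hT] at s12
  simp only [List.append_assoc, List.cons_append, List.nil_append, Nat.zero_add, Nat.add_zero,
    Nat.reduceAdd, twists] at s1 s2 s3 s4 s5 s6 s7 s8 s9 s10 s11 s12 s13 hT ⊢
  refine s1.trans <| s2.trans <| s3.trans <| s4.trans <| s5.trans <| s6.trans <| s7.trans <|
    s8.trans <| s9.trans <| s10.trans <| s11.trans <| ?_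
  rw [hT]
  simp only [List.append_assoc, List.cons_append, List.nil_append]
  exact s12.trans s13

end WeldedEq

end Twists

/-! ### Switching and welding the alternate crossings: the upper bounds. -/

section AlternatingWords

/-- `2n+1` crossings, of the types `slash` and `c` in turn. -/
def alternating (c : Crossing) (n : ℕ) : List Crossing :=
  (List.range (2 * n + 1)).map fun j => if j % 2 = 1 then c else .slash

theorem alternating_succ (c : Crossing) (n : ℕ) :
    alternating c (n + 1) = alternating c n ++ [c, .slash] := by
  unfold alternating
  rw [show 2 * (n + 1) + 1 = 2 * n + 1 + 1 + 1 by ring, List.range_succ, List.range_succ]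
  simp [show (2 * n + 1) % 2 = 1 by omega]

theorem mem_alternateCrossings {n j : ℕ} :
    j ∈ alternateCrossings n ↔ 2 ≤ j ∧ j < 2 * n + 3 ∧ (j - 2) % 2 = 1 := by
  simp only [alternateCrossings, Finset.mem_image, Finset.mem_Icc]
  constructor
  · rintro ⟨k, hk, rfl⟩
    omega
  · intro h
    exact ⟨(j - 1) / 2, by omega, by omega⟩

theorem modifyWord_torusDiagram (f : Crossing → Crossing) (n : ℕ) :
    modifyWord f (alternateCrossings n) (torusDiagram n).word =
      closedTwoBraidWord (alternating (f .slash) n) := by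
  apply List.ext_getElem?
  intro j
  simp only [modifyWord, List.getElem?_mapIdx, mem_alternateCrossings]
  have hc : ∀ l : List Crossing, closedTwoBraidWord l = .cup 0 :: .cup 1 ::
      (l.map (fun c => Slice.crossing c 0) ++ [Slice.cap 1, Slice.cap 0]) := by
    intro l
    simp [closedTwoBraidWord]
  simp only [torusDiagram, hc]
  rcases j with _ | _ | j
  · simp
  · simp
  · simp only [List.getElem?_cons_succ]
    by_cases h : j < 2 * n + 1
    · rw [List.getElem?_append_left (by simpa using h),
        List.getElem?_append_left (by simpa [alternating] using h)]
      by_cases h2 : j % 2 = 1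
      · simp [alternating, h, h2, Slice.mapCrossing,
          show j + 1 + 1 < 2 * n + 3 by omega]
      · simp [alternating, h, h2]
    · rw [List.getElem?_append_right (by simpa using h),
        List.getElem?_append_right (by simpa [alternating] using h)]
      have h3 : ¬ j + 1 + 1 < 2 * n + 3 := by omega
      simp [alternating, h3]

theorem card_alternateCrossings (n : ℕ) : (alternateCrossings n).card = n := by
  rw [alternateCrossings, Finset.card_image_of_injective _ fun a b h => by simpa using h]
  simp

theorem isCrossingSet_alternateCrossings (n : ℕ) :
    (torusDiagram n).IsCrossingSet (alternateCrossings n) := by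
  intro j hj
  obtain ⟨h1, h2, -⟩ := mem_alternateCrossings.1 hj
  obtain ⟨j, rfl⟩ := Nat.exists_eq_add_of_le' h1
  refine ⟨.crossing .slash 0, ?_, .slash, 0, rfl, by simp [Crossing.IsClassical]⟩
  simp only [torusDiagram, closedTwoBraidWord, List.cons_append, List.nil_append,
    List.getElem?_cons_succ]
  rw [List.getElem?_append_left (by simp; omega)]
  simp only [List.map_replicate]
  rw [List.getElem?_replicate, if_pos (by omega)]

/-- The classical diagram given by a closed two-strand braid. -/
def closedTwoBraid (l : List Crossing) (h : .virt ∉ l) : ClassicalDiagram :=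
  ⟨⟨closedTwoBraidWord l, isTangle_closedTwoBraidWord l⟩, by
    rintro p hp ⟨i, rfl⟩
    simp [closedTwoBraidWord] at hp
    exact h hp.1⟩

theorem virt_notMem_alternating (n : ℕ) : Crossing.virt ∉ alternating .backslash n := by
  simp only [alternating, List.mem_map, not_exists, not_and]
  intro j _
  split_ifs <;> simp

theorem link_closedTwoBraid_slash :
    (closedTwoBraid [.slash] (by simp)).link = ClassicalLink.unknot := by
  let D₁ : ClassicalDiagram := ⟨⟨[.cup 0, .cup 0, .crossing .backslash 1, .cap 1, .cap 0],
    by decide⟩, by rintro p hp ⟨i, rfl⟩; simp at hp⟩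
  let D₂ : ClassicalDiagram := ⟨⟨[.cup 0, .cup 0, .cap 1, .cap 0], by decide⟩, by
    rintro p hp ⟨i, rfl⟩; simp at hp⟩
  have h1 : D₁.link = (closedTwoBraid [.slash] (by simp)).link :=
    Quot.sound (Or.inl ⟨[.cup 0], [.cap 1, .cap 0], _, _, .turnCup .backslash 0, rfl, rfl⟩)
  have h2 : D₁.link = D₂.link := Quot.sound (Or.inr ⟨[.cup 0, .cup 0], [.cap 0], _, _,
    .r1Cap .backslash 1 (by simp [Crossing.IsClassical]), rfl, rfl⟩)
  have h3 : D₂.link = ClassicalLink.unknot :=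
    Quot.sound (Or.inl ⟨[.cup 0], [.cap 0], _, _, .zigzagLeft 0, rfl, rfl⟩)
  exact h1.symm.trans (h2.trans h3)

/-- The last two crossings are of opposite types and cancel by a second Reidemeister move. -/
theorem link_closedTwoBraid_alternating (n : ℕ) :
    (closedTwoBraid (alternating .backslash n) (virt_notMem_alternating n)).link =
      ClassicalLink.unknot := by
  induction n with
  | zero => exact link_closedTwoBraid_slash
  | succ n ih =>
    rw [← ih]
    refine Quot.sound (Or.inr ⟨[.cup 0, .cup 1] ++ (alternating .backslash n).map fun c =>
      Slice.crossing c 0, [.cap 1, .cap 0], _, _,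
      .r2 .backslash 0 (by simp [Crossing.IsClassical]), ?_, ?_⟩)
    · simp [closedTwoBraid, closedTwoBraidWord, alternating_succ, Crossing.switch]
    · simp [closedTwoBraid, closedTwoBraidWord]

theorem unknottingNumber_torusKnot_le (n : ℕ) : (torusKnot n).unknottingNumber ≤ (n : ℕ∞) := by
  refine iInf₂_le_of_le ⟨torusDiagram n, isClassical_torusDiagram n⟩ rfl ?_
  refine iInf_le_of_le (alternateCrossings n) ?_
  refine iInf₂_le_of_le (isCrossingSet_alternateCrossings n) ?_ ?_
  · rw [← link_closedTwoBraid_alternating n]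
    refine congrArg ClassicalDiagram.link (Subtype.ext (Diagram.ext ?_))
    exact modifyWord_torusDiagram Crossing.switch n
  · rw [card_alternateCrossings]

theorem map_alternating_virt (n : ℕ) :
    ((alternating .virt n).map fun c => Slice.crossing c 0) = twists n ++ [slashAt 0] := by
  induction n with
  | zero => rfl
  | succ n ih => simp [alternating_succ, ih, twists]

theorem closedTwoBraidWord_alternating_virt (n : ℕ) :
    closedTwoBraidWord (alternating .virt n) =
      [.cup 0, .cup 1] ++ (twists n ++ [slashAt 0, .cap 1, .cap 0]) := by
  rw [closedTwoBraidWord, map_alternating_virt]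
  simp

/-- Every classical step is a welded step, so passage to the welded link descends to classical
links. -/
theorem weldedLink_eq_of_link_eq {D E : ClassicalDiagram} (h : D.link = E.link) :
    D.1.weldedLink = E.1.weldedLink :=
  congrArg (Quot.lift (fun D : ClassicalDiagram => D.1.weldedLink) fun _ _ h =>
    Quot.sound (h.imp_right Or.inl)) h

theorem weldedLink_alternating_virt (n : ℕ) :
    Diagram.weldedLink ⟨closedTwoBraidWord (alternating .virt n),
      isTangle_closedTwoBraidWord _⟩ = WeldedLink.unknot := by
  induction n with
  | zero => exact weldedLink_eq_of_link_eq link_closedTwoBraid_slash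
  | succ n ih =>
    rw [← ih]
    have h := WeldedEq.twists_succ n
    have h1 := h.link_eq [] [] (by simpa using h.left) (by simpa using h.right) rfl rfl
    simpa only [closedTwoBraidWord_alternating_virt, List.nil_append, List.append_nil] using h1

theorem weldedLink_weld_torusDiagram (n : ℕ) :
    ((torusDiagram n).weld (alternateCrossings n)).weldedLink = WeldedLink.unknot := by
  rw [← weldedLink_alternating_virt n]
  exact congrArg Diagram.weldedLink (Diagram.ext (modifyWord_torusDiagram Crossing.weld n))

theorem weldedUnknottingNumber_le (n : ℕ) :
    (weldedTorusKnot n).weldedUnknottingNumber ≤ (n : ℕ∞) := by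
  refine iInf₂_le_of_le (torusDiagram n) rfl ?_
  refine iInf_le_of_le (alternateCrossings n) ?_
  refine iInf₂_le_of_le (isCrossingSet_alternateCrossings n) (weldedLink_weld_torusDiagram n) ?_
  rw [card_alternateCrossings]

end AlternatingWords

/-! ### The welded diagram is descending. -/

section Descending

theorem getElem?_closedTwoBraidWord_alternating {c : Crossing} {n j : ℕ} (h : j < 2 * n + 1) :
    (closedTwoBraidWord (alternating c n))[j + 2]? =
      some (.crossing (if j % 2 = 1 then c else .slash) 0) := by
  simp only [closedTwoBraidWord, List.cons_append, List.nil_append, List.getElem?_cons_succ]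
  rw [List.getElem?_append_left (by simpa [alternating] using h)]
  simp [alternating, h]

theorem getElem?_closedTwoBraidWord_cap (c : Crossing) (n : ℕ) :
    (closedTwoBraidWord (alternating c n))[2 * n + 3]? = some (.cap 1) := by
  simp only [closedTwoBraidWord, List.cons_append, List.nil_append, List.getElem?_cons_succ]
  rw [List.getElem?_append_right (by simp [alternating])]
  simp [alternating]

theorem exists_eq_of_getElem?_eq_crossing {n k i : ℕ} {c : Crossing}
    (hk : (closedTwoBraidWord (alternating .virt n))[k]? = some (.crossing c i))
    (hc : c.IsClassical) : ∃ j, j < 2 * n + 1 ∧ k = j + 2 ∧ j % 2 = 0 := by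
  rcases k with _ | _ | j
  · simp [closedTwoBraidWord] at hk
  · simp [closedTwoBraidWord] at hk
  · by_cases h : j < 2 * n + 1
    · refine ⟨j, h, rfl, ?_⟩
      rw [getElem?_closedTwoBraidWord_alternating h] at hk
      by_contra hj
      rw [if_pos (by omega)] at hk
      simp only [Option.some.injEq, Slice.crossing.injEq] at hk
      exact hc hk.1.symm
    · simp only [closedTwoBraidWord, List.cons_append, List.nil_append,
        List.getElem?_cons_succ] at hk
      rw [List.getElem?_append_right (by simpa [alternating] using h)] at hk
      have := List.mem_of_getElem? hk
      simp at this

/-- The walk from the lower end of the first strand of the braid. -/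
theorem walker_after (n t : ℕ) (ht : t ≤ 6 * n + 5) :
    Walker.after ⟨2, 0, true⟩ (closedTwoBraidWord (alternating .virt n)) t =
      if t ≤ 2 * n + 1 then ⟨t + 2, t % 2, true⟩
      else if t ≤ 4 * n + 3 then ⟨4 * n + 5 - t, 2, false⟩
      else ⟨t - (4 * n + 2), (t + 1) % 2, true⟩ := by
  induction t with
  | zero => rfl
  | succ t ih =>
    have ih := ih (by omega)
    have hcap := getElem?_closedTwoBraidWord_cap .virt n
    have hcup : (closedTwoBraidWord (alternating .virt n))[1]? = some (.cup 1) := rfl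
    rw [Walker.after, Function.iterate_succ_apply', ← Walker.after, ih]
    -- The walk goes up the braid, turns at the maximum `cap 1` at time `2n+1`, comes down along a
    -- closing arc, turns at the minimum `cup 1` at time `4n+3`, and goes up the braid a second
    -- time.
    rcases lt_trichotomy t (2 * n + 1) with h | rfl | h
    · have hc := getElem?_closedTwoBraidWord_alternating (c := .virt) h
      rw [if_pos (by omega), if_pos (by omega)]
      simp only [Walker.next, Walker.slice?, if_true, hc, Slice.pos, Slice.ins, not_lt_zero,
        if_false]
      refine (if_neg (show ¬ 0 + 2 ≤ t % 2 by omega)).trans ?_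
      ext <;> simp
      omega
    · rw [if_pos (by omega), if_neg (by omega), if_pos (by omega)]
      simp only [Walker.next, Walker.slice?, if_true, Slice.pos, Slice.ins, hcap,
        show 2 * n + 1 + 2 = 2 * n + 3 by ring, show (2 * n + 1) % 2 = 1 by omega, lt_irrefl,
        if_false]
      rw [if_neg (by omega)]
      ext <;> simp
      omega
    · rcases lt_trichotomy t (4 * n + 3) with h' | rfl | h'
      · have hc := getElem?_closedTwoBraidWord_alternating (c := .virt) (n := n)
          (j := 4 * n + 2 - t) (by omega)
        rw [if_neg (by omega), if_pos (by omega), if_neg (by omega), if_pos (by omega)]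
        simp only [Walker.next, Walker.slice?, Bool.false_eq_true, if_false,
          show ¬ 4 * n + 5 - t = 0 by omega, show 4 * n + 5 - t - 1 = 4 * n + 2 - t + 2 by omega,
          hc, Slice.pos, Slice.outs, not_lt_zero]
        rw [if_pos (by omega)]
        ext <;> simp [Slice.ins]
        omega
      · rw [if_neg (by omega), if_pos (by omega), if_neg (by omega), if_neg (by omega)]
        simp only [Walker.next, Walker.slice?, Bool.false_eq_true, if_false,
          show 4 * n + 5 - (4 * n + 3) = 2 by omega, show 2 - 1 = 1 by rfl, hcup, Slice.pos,
          Slice.outs]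
        norm_num
        omega
      · have hc := getElem?_closedTwoBraidWord_alternating (c := .virt) (n := n)
          (j := t - (4 * n + 4)) (by omega)
        rw [if_neg (by omega), if_neg (by omega), if_neg (by omega), if_neg (by omega)]
        rw [show t - (4 * n + 4) + 2 = t - (4 * n + 2) by omega] at hc
        simp only [Walker.next, Walker.slice?, if_true, hc, Slice.pos, Slice.ins, not_lt_zero,
          if_false]
        refine (if_neg (show ¬ 0 + 2 ≤ (t + 1) % 2 by omega)).trans ?_
        ext <;> simp <;> omega

theorem isDescending_weld_torusDiagram (n : ℕ) :
    ((torusDiagram n).weld (alternateCrossings n)).IsDescending := by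
  have hw : ((torusDiagram n).weld (alternateCrossings n)).word =
    closedTwoBraidWord (alternating .virt n) := modifyWord_torusDiagram Crossing.weld n
  refine ⟨⟨2, 0, true⟩, ?_, ?_⟩
  · unfold Walker.IsOn
    rw [hw]
    exact ⟨by simp [closedTwoBraidWord], 4, by simp [closedTwoBraidWord, IsTangle, Slice.pos,
      Slice.ins, Slice.outs], by simp⟩
  · rw [hw]
    rintro k p hk ⟨c, i, rfl, hcl⟩
    obtain ⟨j, hj, rfl, hj2⟩ := exists_eq_of_getElem?_eq_crossing hk hcl
    have hc := getElem?_closedTwoBraidWord_alternating (c := .virt) hj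
    rw [if_neg (by omega)] at hc
    -- The second ascent starts at time `4n+4` on the other strand. Since `j` is even, the walker is
    -- at place 0 on the first ascent, hence over, and at place 1 on the second, hence under.
    refine ⟨j, 4 * n + 4 + j, by omega, ?_, ?_, ?_⟩
    · rw [walker_after n j (by omega), if_pos (by omega)]
      exact Or.inl (Or.inl ⟨rfl, rfl, by simp [hc, hj2]⟩)
    · rw [walker_after n _ (by omega), if_neg (by omega), if_neg (by omega)]
      exact Or.inr (Or.inl ⟨rfl, by simp; omega, 0, by simp; omega, hc⟩)
    · intro t ht
      rw [walker_after n t (by omega)]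
      simp only [Walker.GoesUnder, Walker.OnSlash, Walker.OnBackslash, hc]
      split_ifs <;> simp <;> omega

end Descending

end WeldedKnots

theorem mainTheorem10 (n : ℕ) :
    ((WeldedKnots.torusDiagram n).IsCrossingSet (WeldedKnots.alternateCrossings n) ∧
      (WeldedKnots.alternateCrossings n).card = n ∧
      ((WeldedKnots.torusDiagram n).weld (WeldedKnots.alternateCrossings n)).IsDescending ∧
      ((WeldedKnots.torusDiagram n).weld (WeldedKnots.alternateCrossings n)).weldedLink =
        WeldedKnots.WeldedLink.unknot) ∧
    (WeldedKnots.weldedTorusKnot n).weldedUnknottingNumber ≤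
      (WeldedKnots.torusKnot n).unknottingNumber ∧
    (WeldedKnots.torusKnot n).unknottingNumber = (n : ℕ∞) :=
  ⟨⟨WeldedKnots.isCrossingSet_alternateCrossings n, WeldedKnots.card_alternateCrossings n,
    WeldedKnots.isDescending_weld_torusDiagram n, WeldedKnots.weldedLink_weld_torusDiagram n⟩,
    (WeldedKnots.weldedUnknottingNumber_le n).trans
      (WeldedKnots.le_unknottingNumber_torusKnot n),
    le_antisymm (WeldedKnots.unknottingNumber_torusKnot_le n)
      (WeldedKnots.le_unknottingNumber_torusKnot n)⟩
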